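/- Let $d\ge 0$ be an integer, $\mathcal S(\mathbb R^d)$ the Schwartz space (of real- or complex-valued functions; the Hilbert spaces below are taken over the same field $\mathbb K\in\{\mathbb R,\mathbb C\}$), $L_0=\Delta-x\cdot\nabla$ with domain $D(L_0)=\mathcal S(\mathbb R^d)$, and $\mu(dx)=\rho(x)\,dx$ with $\rho(x)=(2\pi)^{-d/2}e^{-|x|^2/2}$. Then: 1. $L_0$ is densely defined in $L^2(\mathbb R^d,dx)$ and its adjoint there is $\Delta+x\cdot\nabla+d$. That is, the adjoint extends the operator $\Delta+x\cdot\nabla+d$ on $\mathcal S(\mathbb R^d)$, and, for $g,h\in L^2(\mathbb R^d,dx)$, one has $g\in D(L_0^*)$ and $L_0^*g=h$ if and only if $\Delta g+x\cdot\nabla g+d\,g=h$ in the sense of tempered distributions. 2. $\mu$ is $(L_0,\mathcal S(\mathbb R^d))$-invariant: $\mathcal S(\mathbb R^d)$ is dense in $L^2(\mathbb R^d,\mu)$, and for every $f\in\mathcal S(\mathbb R^d)$ the function $L_0f$ is $\mu$-integrable and $\int L_0f\,d\mu=0$. 3. The adjoint of $(L_0,\mathcal S(\mathbb R^d))$ in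 $L^2(\mathbb R^d,\mu)$ is equal to $L_0$ on $\mathcal S(\mathbb R^d)$; thus $L_0$ is symmetric in $L^2(\mathbb R^d,\mu)$. 4. $(L_0,\mathcal S(\mathbb R^d))$ is closable in $L^2(\mathbb R^d,\mu)$ and its closure $\overline L_0$ is self-adjoint. 5. $\overline L_0$ is the infinitesimal generator of exactly one strongly continuous contraction semigroup $(e^{t\overline L_0})_{t\ge 0}$ in $L^2(\mathbb R^d,\mu)$, and $\mu$ is invariant under it: $\int e^{t\overline L_0}f\,d\mu=\int f\,d\mu$ for all $t\ge0$ and all $f\in L^2(\mathbb R^d,\mu)$. -/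

import Mathlib

open MeasureTheory Filter
open scoped SchwartzMap Laplacian LineDeriv Topology ENNReal NNReal

noncomputable section

namespace OrnsteinUhlenbeck

/-- The space `ℝ^d` with its Euclidean norm. -/
abbrev Rd (d : ℕ) : Type := EuclideanSpace ℝ (Fin d)

/-- The `i`-th standard basis vector of `ℝ^d`. -/
abbrev basisVec {d : ℕ} (i : Fin d) : Rd d := EuclideanSpace.single i (1 : ℝ)

section Measure

/-- The standard Gaussian density `ρ(x) = exp(-|x|²/2) / (2π)^(d/2)`. -/
def rho (d : ℕ) (x : Rd d) : ℝ :=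
  Real.exp (-‖x‖ ^ 2 / 2) / (2 * Real.pi) ^ ((d : ℝ) / 2)

/-- The measure `μ(dx) = ρ(x) dx` on `ℝ^d`. -/
def gauss (d : ℕ) : Measure (Rd d) :=
  (volume : Measure (Rd d)).withDensity fun x => ENNReal.ofReal (rho d x)

theorem rho_pos (d : ℕ) (x : Rd d) : 0 < rho d x := by
  unfold rho
  positivity

theorem continuous_rho (d : ℕ) : Continuous (rho d) := by
  unfold rho
  fun_prop

theorem integral_rho (d : ℕ) : ∫ x, rho d x = 1 := by
  have h := GaussianFourier.integral_rexp_neg_mul_sq_norm (V := Rd d)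
    (show (0 : ℝ) < 1 / 2 by norm_num)
  have h2 : (fun x : Rd d => rho d x) = fun x =>
      Real.exp (-(1 / 2) * ‖x‖ ^ 2) / (2 * Real.pi) ^ ((d : ℝ) / 2) := by
    funext x
    unfold rho
    congr 2
    ring
  have h3 : Real.pi / (1 / 2) = 2 * Real.pi := by ring
  have h4 : (0 : ℝ) < (2 * Real.pi) ^ ((d : ℝ) / 2) := by positivity
  rw [h2, integral_div, h, h3, finrank_euclideanSpace_fin]
  exact div_self h4.ne'

instance isProbabilityMeasure_gauss (d : ℕ) : IsProbabilityMeasure (gauss d) := by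
  have hint : Integrable (rho d) := by
    by_contra hn
    have := integral_undef hn
    rw [integral_rho] at this
    exact one_ne_zero this
  constructor
  rw [gauss, withDensity_apply _ MeasurableSet.univ, Measure.restrict_univ,
    ← ofReal_integral_eq_lintegral_ofReal hint (ae_of_all _ fun x => (rho_pos d x).le),
    integral_rho, ENNReal.ofReal_one]

instance isOpenPosMeasure_gauss (d : ℕ) : (gauss d).IsOpenPosMeasure := by
  have h : (volume : Measure (Rd d)) ≪ gauss d := by
    refine withDensity_absolutelyContinuous' ?_ ?_
    · exact ((continuous_rho d).measurable.ennreal_ofReal).aemeasurable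
    · exact ae_of_all _ fun x => by simp [rho_pos d x]
  exact h.isOpenPosMeasure

end Measure

section Operators

variable (𝕜 : Type*) [RCLike 𝕜] (d : ℕ)

/-- The operator `f ↦ x · ∇f = ∑ᵢ xᵢ ∂ᵢ f` on the Schwartz space `S(ℝ^d)`. -/
def eulerOp : 𝓢(Rd d, 𝕜) →ₗ[𝕜] 𝓢(Rd d, 𝕜) :=
  ∑ i : Fin d, (SchwartzMap.smulLeftCLM 𝕜 (fun x : Rd d => ((x i : ℝ) : 𝕜))).toLinearMap ∘ₗ
    (LineDeriv.lineDerivOpCLM 𝕜 𝓢(Rd d, 𝕜) (basisVec i)).toLinearMap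

/-- The Laplacian on the Schwartz space, as a linear map. -/
def lapOp : 𝓢(Rd d, 𝕜) →ₗ[𝕜] 𝓢(Rd d, 𝕜) :=
  (LineDeriv.laplacianCLM 𝕜 (Rd d) 𝓢(Rd d, 𝕜)).toLinearMap

/-- The operator `Δ - x · ∇` on the Schwartz space. -/
def ouOp : 𝓢(Rd d, 𝕜) →ₗ[𝕜] 𝓢(Rd d, 𝕜) := lapOp 𝕜 d - eulerOp 𝕜 d

/-- The operator `Δ + x · ∇ + d` on the Schwartz space. -/
def ouDualOp : 𝓢(Rd d, 𝕜) →ₗ[𝕜] 𝓢(Rd d, 𝕜) :=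
  lapOp 𝕜 d + eulerOp 𝕜 d + (d : 𝕜) • LinearMap.id

variable {𝕜 d}

theorem lapOp_apply (f : 𝓢(Rd d, 𝕜)) (x : Rd d) : lapOp 𝕜 d f x = Δ (f : Rd d → 𝕜) x := by
  rw [← SchwartzMap.laplacian_apply, ← SchwartzMap.laplacianCLM_eq (𝕜 := 𝕜)]
  rfl

theorem eulerOp_apply (f : 𝓢(Rd d, 𝕜)) (x : Rd d) :
    eulerOp 𝕜 d f x = fderiv ℝ (f : Rd d → 𝕜) x x := by
  have hg : ∀ i : Fin d, Function.HasTemperateGrowth fun x : Rd d => ((x i : ℝ) : 𝕜) := by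
    intro i
    exact ((RCLike.ofRealCLM (K := 𝕜)).comp
      (EuclideanSpace.proj i : Rd d →L[ℝ] ℝ)).hasTemperateGrowth
  have hx : ∑ i : Fin d, x i • basisVec i = x := by
    simpa using (EuclideanSpace.basisFun (Fin d) ℝ).sum_repr x
  have hsum : fderiv ℝ (f : Rd d → 𝕜) x x =
      ∑ i : Fin d, fderiv ℝ (f : Rd d → 𝕜) x (x i • basisVec i) := by
    rw [← map_sum, hx]
  rw [hsum]
  simp only [eulerOp, LinearMap.sum_apply, _root_.sum_apply]
  refine Finset.sum_congr rfl fun i _ => ?_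
  change SchwartzMap.smulLeftCLM 𝕜 (fun x : Rd d => ((x i : ℝ) : 𝕜)) (∂_{basisVec i} f) x = _
  rw [SchwartzMap.smulLeftCLM_apply_apply (hg i), SchwartzMap.lineDerivOp_apply_eq_fderiv,
    map_smul, smul_eq_mul, RCLike.real_smul_eq_coe_mul]

theorem ouOp_apply (f : 𝓢(Rd d, 𝕜)) (x : Rd d) :
    ouOp 𝕜 d f x = Δ (f : Rd d → 𝕜) x - fderiv ℝ (f : Rd d → 𝕜) x x := by
  rw [← lapOp_apply, ← eulerOp_apply]
  rfl

theorem ouDualOp_apply (f : 𝓢(Rd d, 𝕜)) (x : Rd d) :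
    ouDualOp 𝕜 d f x =
      Δ (f : Rd d → 𝕜) x + fderiv ℝ (f : Rd d → 𝕜) x x + (d : 𝕜) * f x := by
  rw [← lapOp_apply, ← eulerOp_apply]
  rfl

section Lp

variable (ν : Measure (Rd d)) [ν.HasTemperateGrowth] [ν.IsOpenPosMeasure]

/-- The (injective) inclusion of the Schwartz space in `L²(ν)`. -/
def schwartzToL2 : 𝓢(Rd d, 𝕜) →ₗ[𝕜] Lp 𝕜 2 ν := (SchwartzMap.toLpCLM 𝕜 𝕜 2 ν).toLinearMap

theorem schwartzToL2_injective :
    Function.Injective (schwartzToL2 ν : 𝓢(Rd d, 𝕜) →ₗ[𝕜] Lp 𝕜 2 ν) :=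
  SchwartzMap.injective_toLp 2 ν

/-- A linear operator `A : S(ℝ^d) → S(ℝ^d)`, seen as an unbounded operator in `L²(ν)` whose domain
is (the image of) `S(ℝ^d)`. -/
def onSchwartz (A : 𝓢(Rd d, 𝕜) →ₗ[𝕜] 𝓢(Rd d, 𝕜)) : Lp 𝕜 2 ν →ₗ.[𝕜] Lp 𝕜 2 ν where
  domain := LinearMap.range (schwartzToL2 ν : 𝓢(Rd d, 𝕜) →ₗ[𝕜] Lp 𝕜 2 ν)
  toFun := schwartzToL2 ν ∘ₗ A ∘ₗ
    (LinearEquiv.ofInjective (schwartzToL2 ν) (schwartzToL2_injective ν)).symm.toLinearMap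

theorem onSchwartz_apply (A : 𝓢(Rd d, 𝕜) →ₗ[𝕜] 𝓢(Rd d, 𝕜)) (f : 𝓢(Rd d, 𝕜)) :
    onSchwartz ν A ⟨schwartzToL2 ν f, LinearMap.mem_range_self _ f⟩ = schwartzToL2 ν (A f) := by
  have h : (LinearEquiv.ofInjective (schwartzToL2 ν) (schwartzToL2_injective ν)).symm
      ⟨schwartzToL2 ν f, LinearMap.mem_range_self _ f⟩ = f := by
    rw [LinearEquiv.symm_apply_eq]
    rfl
  change schwartzToL2 ν (A ((LinearEquiv.ofInjective (schwartzToL2 ν)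
    (schwartzToL2_injective ν)).symm ⟨schwartzToL2 ν f, LinearMap.mem_range_self _ f⟩)) = _
  rw [h]

end Lp

/-- For `g, h ∈ L²(dx)`: the equation `Δg + x · ∇g + d g = h` holds in the sense of (tempered)
distributions. Tested against `φ`, the distribution `Δg` gives `∫ g Δφ`, the distribution
`xᵢ ∂ᵢ g` gives `-∫ g ∂ᵢ(xᵢ φ)`, and `d g` gives `d ∫ g φ`. -/
def SolvesDualWeakly (g h : Lp 𝕜 2 (volume : Measure (Rd d))) : Prop :=
  ∀ φ : 𝓢(Rd d, 𝕜),
    (∫ x, g x * Δ (φ : Rd d → 𝕜) x)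
      - (∑ i : Fin d, ∫ x, g x * lineDeriv ℝ (fun y : Rd d => ((y i : ℝ) : 𝕜) * φ y) x (basisVec i))
      + (d : 𝕜) * (∫ x, g x * φ x)
    = ∫ x, h x * φ x

end Operators

section Semigroups

variable {𝕜 : Type*} [RCLike 𝕜]

/-- Strongly continuous one-parameter contraction semigroups on a normed space. -/
structure IsC0ContractionSemigroup {H : Type*} [NormedAddCommGroup H] [NormedSpace 𝕜 H]
    (T : ℝ≥0 → H →L[𝕜] H) : Prop where
  zero : T 0 = ContinuousLinearMap.id 𝕜 H
  add : ∀ s t, T (s + t) = (T s).comp (T t)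
  continuous : ∀ x, Continuous fun t => T t x
  contraction : ∀ t, ‖T t‖ ≤ 1

/-- `A` is the infinitesimal generator of `T`: `x ∈ D(A)` and `A x = y` if and only if
`(T t x - x) / t` converges to `y` in norm as `t ↓ 0`. -/
def IsGenerator {H : Type*} [NormedAddCommGroup H] [NormedSpace 𝕜 H]
    (A : H →ₗ.[𝕜] H) (T : ℝ≥0 → H →L[𝕜] H) : Prop :=
  ∀ x y : H, (x, y) ∈ A.graph ↔
    Tendsto (fun t : ℝ≥0 => (((t : ℝ)⁻¹ : ℝ) : 𝕜) • (T t x - x)) (𝓝[>] 0) (𝓝 y)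

variable {X : Type*} [MeasurableSpace X]

/-- `μ` is `(A, D(A))`-invariant: the operator `A` in `L²(μ)` is densely defined and
`∫ A f dμ = 0` for all `f ∈ D(A)`. -/
def IsOperatorInvariant (μ : Measure X) (A : Lp 𝕜 2 μ →ₗ.[𝕜] Lp 𝕜 2 μ) : Prop :=
  Dense (A.domain : Set (Lp 𝕜 2 μ)) ∧
    ∀ f : A.domain, Integrable (A f : X → 𝕜) μ ∧ ∫ x, (A f : X → 𝕜) x ∂μ = 0

/-- `μ` is invariant under the operators `T t` in `L²(μ)`: `∫ T t f dμ = ∫ f dμ` for all `t` and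
all `f ∈ L²(μ)`. -/
def IsSemigroupInvariant (μ : Measure X) (T : ℝ≥0 → Lp 𝕜 2 μ →L[𝕜] Lp 𝕜 2 μ) : Prop :=
  ∀ (t : ℝ≥0) (f : Lp 𝕜 2 μ), Integrable (T t f : X → 𝕜) μ ∧ Integrable (f : X → 𝕜) μ ∧
    ∫ x, (T t f : X → 𝕜) x ∂μ = ∫ x, (f : X → 𝕜) x ∂μ

/-- A densely defined operator is symmetric if its adjoint extends it. -/
def IsSymmetricOp {H : Type*} [NormedAddCommGroup H] [InnerProductSpace 𝕜 H] [CompleteSpace H]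
    (A : H →ₗ.[𝕜] H) : Prop :=
  Dense (A.domain : Set H) ∧ A ≤ A.adjoint

end Semigroups

end OrnsteinUhlenbeck

end

open OrnsteinUhlenbeck

/-!
Gaussian integration by parts gives `⟪L₀ f, g⟫ = -∫ ⟪∇f, ∇g⟫ dμ`, so `L₀` is symmetric and
dissipative in `L²(μ)`. By Hille–Yosida and the basic criterion for self-adjointness, everything
about the closure then follows once `c - L₀` has dense range for all `c > 0`.

To see this, let `u` be orthogonal to that range. For plane waves `w(x) = cos(⟪a, x⟫ + θ)` one has
`L₀ w = -|a|² w - x · ∇w`, so `m(r) = ∫ u(x) cos(r ⟪a, x⟫ + θ) dμ` solves the Euler-type equation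
`(c + |a|² r²) m + r m' = 0`. Its solutions are multiples of `r ^ (-c) * exp (-|a|² r² / 2)`, which
blow up at `0`, while `m` is continuous there; hence `m = 0`, and the measure `u dμ` has zero
characteristic function. Plane waves are not Schwartz functions, so they are cut off by dilates
`χ(ε ·)` of a Schwartz function with `χ(0) = 1`, and `ε → 0`.

The semigroup preserves `μ` because `f ↦ ∫ f dμ` is a continuous functional vanishing on the range
of the closure.
-/

noncomputable section

namespace OrnsteinUhlenbeck

section PointwiseConvergence

variable {𝕜 : Type*} [RCLike 𝕜] {E : Type*} [NormedAddCommGroup E] [NormedSpace 𝕜 E]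

theorem equicontinuous_of_norm_le {ι : Type*} {F : ι → E →L[𝕜] E} {C : ℝ}
    (hF : ∀ i, ‖F i‖ ≤ C) : Equicontinuous fun i x => F i x := by
  have h : (∃ C, ∀ i, ‖F i‖ ≤ C) ↔ Equicontinuous (DFunLike.coe ∘ F) :=
    (NormedSpace.equicontinuous_TFAE F).out 5 1
  exact h.1 ⟨C, hF⟩

theorem tendsto_apply_of_dense {ι : Type*} {l : Filter ι} {F : ι → E →L[𝕜] E} {G : E →L[𝕜] E}
    {C : ℝ} (hF : ∀ i, ‖F i‖ ≤ C) {D : Set E} (hD : Dense D)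
    (h : ∀ x ∈ D, Tendsto (fun i => F i x) l (𝓝 (G x))) (x : E) :
    Tendsto (fun i => F i x) l (𝓝 (G x)) := by
  have hclosed := (equicontinuous_of_norm_le hF).isClosed_setOfPred_tendsto (l := l) G.continuous
  exact closure_minimal h hclosed (hD x)

theorem cauchySeq_apply_of_dense {F : ℕ → E →L[𝕜] E} (hF : ∀ n, ‖F n‖ ≤ 1) {D : Set E}
    (hD : Dense D) (h : ∀ x ∈ D, CauchySeq fun n => F n x) (x : E) :
    CauchySeq fun n => F n x := by
  have iff_tendsto (z : E) : CauchySeq (fun n => F n z) ↔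
      Tendsto (fun n : ℕ × ℕ => (F n.1 - F n.2) z) atTop (𝓝 ((0 : E →L[𝕜] E) z)) := by
    simp only [cauchySeq_iff_tendsto_dist_atTop_0, dist_eq_norm, zero_apply, sub_apply]
    exact tendsto_zero_iff_norm_tendsto_zero.symm
  have hbound (n : ℕ × ℕ) : ‖F n.1 - F n.2‖ ≤ 1 + 1 :=
    (norm_sub_le _ _).trans (add_le_add (hF _) (hF _))
  exact (iff_tendsto x).2
    (tendsto_apply_of_dense hbound hD (fun z hz => (iff_tendsto z).1 (h z hz)) x)

theorem exists_tendsto_apply_of_dense [CompleteSpace E] {F : ℕ → E →L[𝕜] E}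
    (hF : ∀ n, ‖F n‖ ≤ 1) {D : Set E} (hD : Dense D) (h : ∀ x ∈ D, CauchySeq fun n => F n x) :
    ∃ G : E →L[𝕜] E, ‖G‖ ≤ 1 ∧ ∀ x, Tendsto (fun n => F n x) atTop (𝓝 (G x)) := by
  choose g hg using fun x => cauchySeq_tendsto_of_complete (cauchySeq_apply_of_dense hF hD h x)
  refine ⟨continuousLinearMapOfTendsto F (tendsto_pi_nhds.2 hg), ?_, hg⟩
  exact ContinuousLinearMap.opNorm_le_bound _ zero_le_one fun x =>
    le_of_tendsto' (hg x).norm fun n => (F n).le_of_opNorm_le (hF n) x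

theorem tendsto_apply_apply_of_norm_le {ι : Type*} {l : Filter ι} {F : ι → E →L[𝕜] E}
    {G : E →L[𝕜] E} {C : ℝ} (hF : ∀ i, ‖F i‖ ≤ C)
    (h : ∀ x, Tendsto (fun i => F i x) l (𝓝 (G x))) {u : ι → E} {x : E}
    (hu : Tendsto u l (𝓝 x)) : Tendsto (fun i => F i (u i)) l (𝓝 (G x)) := by
  have hzero : Tendsto (fun i => F i (u i - x)) l (𝓝 0) :=
    squeeze_zero_norm (fun i => (F i).le_of_opNorm_le (hF i) _)
      (by simpa using (tendsto_iff_norm_sub_tendsto_zero.1 hu).const_mul C)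
  simpa using hzero.add (h x)

end PointwiseConvergence

section Dissipative

variable {𝕜 : Type*} [RCLike 𝕜] {E : Type*} [NormedAddCommGroup E] [NormedSpace 𝕜 E]

/-- A linear relation `G ⊆ E × E`, thought of as the graph of an operator `A`, is dissipative if
`c ‖x‖ ≤ ‖c x - A x‖` for all `c > 0`. -/
def IsDissipative (G : Submodule 𝕜 (E × E)) : Prop :=
  ∀ ⦃c : ℝ⦄, 0 < c → ∀ ⦃x y : E⦄, (x, y) ∈ G → c * ‖x‖ ≤ ‖(c : 𝕜) • x - y‖

/-- The operator `c - A`, as a bounded operator on the graph of `A`. -/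
def shift (G : Submodule 𝕜 (E × E)) (c : ℝ) : G →L[𝕜] E :=
  ((c : 𝕜) • ContinuousLinearMap.fst 𝕜 E E - ContinuousLinearMap.snd 𝕜 E E).comp G.subtypeL

theorem shift_apply (G : Submodule 𝕜 (E × E)) (c : ℝ) (p : G) :
    shift G c p = (c : 𝕜) • p.1.1 - p.1.2 := rfl

theorem IsDissipative.topologicalClosure {G : Submodule 𝕜 (E × E)} (hG : IsDissipative G) :
    IsDissipative G.topologicalClosure := by
  intro c hc x y hxy
  have hclosed : IsClosed {p : E × E | c * ‖p.1‖ ≤ ‖(c : 𝕜) • p.1 - p.2‖} :=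
    isClosed_le (by fun_prop) (by fun_prop)
  exact closure_minimal (fun p hp => hG hc hp) hclosed hxy

theorem IsDissipative.antilipschitz_shift {G : Submodule 𝕜 (E × E)} (hG : IsDissipative G) {c : ℝ}
    (hc : 0 < c) : AntilipschitzWith (Real.toNNReal (c⁻¹ + 2)) (shift G c) := by
  refine ContinuousLinearMap.antilipschitz_of_bound _ fun p => ?_
  have hfst : c * ‖p.1.1‖ ≤ ‖shift G c p‖ := hG hc p.2
  have hsnd : ‖p.1.2‖ ≤ 2 * ‖shift G c p‖ :=
    calc ‖p.1.2‖ = ‖(c : 𝕜) • p.1.1 - shift G c p‖ := by rw [shift_apply, sub_sub_cancel]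
      _ ≤ ‖(c : 𝕜) • p.1.1‖ + ‖shift G c p‖ := norm_sub_le _ _
      _ ≤ 2 * ‖shift G c p‖ := by
        rw [norm_smul, RCLike.norm_ofReal, abs_of_pos hc]
        linarith
  have hfst' : ‖p.1.1‖ ≤ c⁻¹ * ‖shift G c p‖ := by rwa [inv_mul_eq_div, le_div_iff₀' hc]
  rw [Real.coe_toNNReal _ (by positivity), add_mul]
  exact max_le (hfst'.trans (le_add_of_nonneg_right (by positivity)))
    (hsnd.trans (le_add_of_nonneg_left (by positivity)))

theorem IsDissipative.surjective_shift_topologicalClosure [CompleteSpace E]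
    {G : Submodule 𝕜 (E × E)} (hG : IsDissipative G) {c : ℝ} (hc : 0 < c)
    (hrange : DenseRange (shift G c)) : Function.Surjective (shift G.topologicalClosure c) := by
  have : CompleteSpace G.topologicalClosure :=
    G.isClosed_topologicalClosure.completeSpace_coe
  have hclosed : IsClosed (Set.range (shift G.topologicalClosure c)) :=
    (hG.topologicalClosure.antilipschitz_shift hc).isClosed_range
      (shift G.topologicalClosure c).uniformContinuous
  have hsubset : Set.range (shift G c) ⊆ Set.range (shift G.topologicalClosure c) := by
    rintro _ ⟨p, rfl⟩
    exact ⟨⟨p, G.le_topologicalClosure p.2⟩, rfl⟩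
  exact Set.range_eq_univ.1 (hclosed.closure_eq ▸ (hrange.mono hsubset).closure_eq)

/-- A densely defined dissipative operator `A` is m-dissipative if `c - A` is onto for all
`c > 0`. -/
structure IsMDissipative (A : E →ₗ.[𝕜] E) : Prop where
  dense : Dense (A.domain : Set E)
  isDissipative : IsDissipative A.graph
  surjective_shift : ∀ ⦃c : ℝ⦄, 0 < c → Function.Surjective (shift A.graph c)

theorem IsDissipative.isMDissipative_closure [CompleteSpace E] {A : E →ₗ.[𝕜] E}
    (hA : IsDissipative A.graph) (hdense : Dense (A.domain : Set E)) (hclosable : A.IsClosable)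
    (hrange : ∀ c : ℝ, 0 < c → DenseRange (shift A.graph c)) : IsMDissipative A.closure := by
  refine ⟨hdense.mono A.le_closure.1, ?_, fun c hc => ?_⟩ <;>
    rw [← hclosable.graph_closure_eq_closure_graph]
  · exact hA.topologicalClosure
  · exact hA.surjective_shift_topologicalClosure hc (hrange c hc)

section

variable [NormedSpace ℝ E] [IsScalarTower ℝ 𝕜 E]

/-- Dissipativity compares `u z` with `u z - (z - s) u' z`, which differs from `u s` by
`o(z - s)`. -/
theorem IsDissipative.norm_le_of_hasDerivWithinAt {G : Submodule 𝕜 (E × E)} (hG : IsDissipative G)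
    {u u' : ℝ → E} (hu : Continuous u) (hu' : Continuous u')
    (hderiv : ∀ s, 0 ≤ s → HasDerivWithinAt u (u' s) (Set.Ici s) s)
    (hmem : ∀ s, 0 ≤ s → (u s, u' s) ∈ G) {t : ℝ} (ht : 0 ≤ t) : ‖u t‖ ≤ ‖u 0‖ := by
  refine image_le_of_liminf_slope_right_le_deriv_boundary (f := fun s => ‖u s‖) (a := 0) (b := t)
    hu.norm.continuousOn (B := fun _ => ‖u 0‖) (B' := fun _ => 0) le_rfl continuousOn_const
    (fun s _ => hasDerivWithinAt_const _ _ _) (fun s hs r hr => Eventually.frequently ?_)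
    (Set.right_mem_Icc.2 ht)
  have hslope : Tendsto (fun z => ‖slope u s z - u' z‖) (𝓝[>] s) (𝓝 0) := by
    have h := (hasDerivWithinAt_iff_tendsto_slope' Set.self_notMem_Ioi).1
      (hderiv s hs.1).Ioi_of_Ici
    simpa using (h.sub (hu'.tendsto s |>.mono_left nhdsWithin_le_nhds)).norm
  filter_upwards [hslope.eventually_lt_const hr, self_mem_nhdsWithin] with z hz hsz
  have hpos : 0 < (z - s)⁻¹ := inv_pos.2 (sub_pos.2 hsz)
  have hslope_norm :=
    calc (z - s)⁻¹ * ‖u z‖ ≤ ‖(((z - s)⁻¹ : ℝ) : 𝕜) • u z - u' z‖ :=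
          hG hpos (hmem z (hs.1.trans (le_of_lt hsz)))
      _ = ‖(z - s)⁻¹ • u s + (slope u s z - u' z)‖ := by
          rw [slope_def_module, ← RCLike.real_smul_eq_coe_smul]
          congr 1
          module
      _ ≤ (z - s)⁻¹ * ‖u s‖ + ‖slope u s z - u' z‖ :=
          (norm_add_le _ _).trans_eq (by rw [norm_smul, Real.norm_of_nonneg hpos.le])
  rw [slope_def_module, smul_eq_mul, mul_sub]
  linarith

end

end Dissipative

section Semigroup

variable {𝕜 : Type*} [RCLike 𝕜] {E : Type*} [NormedAddCommGroup E] [NormedSpace 𝕜 E]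
  {T T' : ℝ≥0 → E →L[𝕜] E} {A : E →ₗ.[𝕜] E}

theorem IsC0ContractionSemigroup.continuous_toNNReal (hT : IsC0ContractionSemigroup T) (x : E) :
    Continuous fun s : ℝ => T s.toNNReal x :=
  (hT.continuous x).comp continuous_real_toNNReal

theorem isC0ContractionSemigroup_of_tendsto_zero (hzero : T 0 = ContinuousLinearMap.id 𝕜 E)
    (hadd : ∀ s t, T (s + t) = (T s).comp (T t)) (hnorm : ∀ t, ‖T t‖ ≤ 1) {D : Set E}
    (hD : Dense D) (hlim : ∀ x ∈ D, Tendsto (fun t => T t x) (𝓝 0) (𝓝 x)) :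
    IsC0ContractionSemigroup T := by
  refine ⟨hzero, hadd, fun x => continuous_iff_continuousAt.2 fun t => ?_, hnorm⟩
  have hlim_zero : Tendsto (fun r => T r x - x) (𝓝 0) (𝓝 0) := by
    have h : Tendsto (fun r => T r x) (𝓝 0) (𝓝 x) :=
      tendsto_apply_of_dense (G := ContinuousLinearMap.id 𝕜 E) hnorm hD hlim x
    simpa using h.sub_const x
  have hle {s t : ℝ≥0} (hst : s ≤ t) : ‖T t x - T s x‖ ≤ ‖T (nndist t s) x - x‖ := by
    obtain ⟨r, rfl⟩ := exists_add_of_le hst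
    have hr : nndist (s + r) s = r := by
      rw [← NNReal.coe_inj, coe_nndist, NNReal.dist_eq]
      simp
    rw [hadd, hr, ContinuousLinearMap.comp_apply, ← map_sub]
    exact (T s).le_of_opNorm_le_of_le (hnorm s) le_rfl |>.trans_eq (one_mul _)
  have hdist : Tendsto (fun s => nndist s t) (𝓝 t) (𝓝 0) := by
    simpa using (tendsto_id (x := 𝓝 t)).nndist (tendsto_const_nhds (x := t))
  refine tendsto_iff_norm_sub_tendsto_zero.2 (squeeze_zero (fun _ => norm_nonneg _) (fun s => ?_)
    (by simpa using (hlim_zero.comp hdist).norm))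
  rcases le_total s t with hst | hts
  · rw [norm_sub_rev, nndist_comm]
    exact hle hst
  · exact hle hts

theorem mul_norm_le_of_tendsto (hT : ∀ t, ‖T t‖ ≤ 1) {x y : E}
    (hxy : Tendsto (fun t : ℝ≥0 => (((t : ℝ)⁻¹ : ℝ) : 𝕜) • (T t x - x)) (𝓝[>] 0) (𝓝 y)) (c : ℝ) :
    c * ‖x‖ ≤ ‖(c : 𝕜) • x - y‖ := by
  refine ge_of_tendsto' (hxy.const_sub ((c : 𝕜) • x)).norm fun t => ?_
  have hadd : (c + (t : ℝ)⁻¹) * ‖x‖ ≤ ‖((c + (t : ℝ)⁻¹ : ℝ) : 𝕜) • x‖ := by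
    rw [norm_smul, RCLike.norm_ofReal]
    exact mul_le_mul_of_nonneg_right (le_abs_self _) (norm_nonneg x)
  have hcontr : ‖(((t : ℝ)⁻¹ : ℝ) : 𝕜) • T t x‖ ≤ (t : ℝ)⁻¹ * ‖x‖ := by
    rw [norm_smul, RCLike.norm_ofReal, abs_of_nonneg (by positivity)]
    gcongr
    simpa using (T t).le_of_opNorm_le (hT t) x
  calc c * ‖x‖ = (c + (t : ℝ)⁻¹) * ‖x‖ - (t : ℝ)⁻¹ * ‖x‖ := by ring
    _ ≤ ‖((c + (t : ℝ)⁻¹ : ℝ) : 𝕜) • x - (((t : ℝ)⁻¹ : ℝ) : 𝕜) • T t x‖ := by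
      linarith [norm_sub_norm_le (((c + (t : ℝ)⁻¹ : ℝ) : 𝕜) • x) ((((t : ℝ)⁻¹ : ℝ) : 𝕜) • T t x)]
    _ = ‖(c : 𝕜) • x - (((t : ℝ)⁻¹ : ℝ) : 𝕜) • (T t x - x)‖ := by
      congr 1
      push_cast
      module

/-- An m-dissipative operator has no proper dissipative extension, so it only has to be contained
in the generator. -/
theorem isGenerator_of_surjective_shift (hA : Function.Surjective (shift A.graph 1))
    (hT : ∀ t, ‖T t‖ ≤ 1)
    (hsub : ∀ x y, (x, y) ∈ A.graph →
      Tendsto (fun t : ℝ≥0 => (((t : ℝ)⁻¹ : ℝ) : 𝕜) • (T t x - x)) (𝓝[>] 0) (𝓝 y)) :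
    IsGenerator A T := by
  refine fun x y => ⟨hsub x y, fun hxy => ?_⟩
  obtain ⟨⟨⟨v, w⟩, hvw⟩, hv⟩ := hA (x - y)
  rw [shift_apply, RCLike.ofReal_one, one_smul, sub_eq_sub_iff_sub_eq_sub] at hv
  have hdiff : Tendsto (fun t : ℝ≥0 => (((t : ℝ)⁻¹ : ℝ) : 𝕜) • (T t (v - x) - (v - x))) (𝓝[>] 0)
      (𝓝 (w - y)) := by
    refine ((hsub v w hvw).sub hxy).congr fun t => ?_
    rw [map_sub]
    module
  have hnorm := mul_norm_le_of_tendsto hT hdiff 1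
  rw [RCLike.ofReal_one, one_smul, one_mul, hv, sub_self, norm_zero, norm_le_zero_iff,
    ← hv] at hnorm
  rw [hnorm] at hv
  rwa [← sub_eq_zero.1 hnorm, ← sub_eq_zero.1 hv.symm]

theorem IsGenerator.isDissipative (hT : IsC0ContractionSemigroup T) (hA : IsGenerator A T) :
    IsDissipative A.graph :=
  fun c _ x y hxy => mul_norm_le_of_tendsto hT.contraction ((hA x y).1 hxy) c

theorem IsGenerator.mem_graph (hT : IsC0ContractionSemigroup T) (hA : IsGenerator A T) {x y : E}
    (hxy : (x, y) ∈ A.graph) (t : ℝ≥0) : (T t x, T t y) ∈ A.graph := by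
  rw [hA]
  refine (((T t).continuous.tendsto y).comp ((hA x y).1 hxy)).congr fun s => ?_
  rw [Function.comp_apply, map_smul, map_sub, ← ContinuousLinearMap.comp_apply,
    ← ContinuousLinearMap.comp_apply, ← hT.add, ← hT.add, add_comm]

variable [NormedSpace ℝ E] [IsScalarTower ℝ 𝕜 E]

theorem IsGenerator.hasDerivWithinAt (hT : IsC0ContractionSemigroup T) (hA : IsGenerator A T)
    {x y : E} (hxy : (x, y) ∈ A.graph) {t : ℝ} (ht : 0 ≤ t) :
    HasDerivWithinAt (fun s : ℝ => T s.toNNReal x) (T t.toNNReal y) (Set.Ici t) t := by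
  rw [← hasDerivWithinAt_Ioi_iff_Ici, hasDerivWithinAt_iff_tendsto_slope' Set.self_notMem_Ioi]
  have hzero := (hA _ _).1 (hA.mem_graph hT hxy t.toNNReal)
  have hsub : Tendsto (fun s : ℝ => (s - t).toNNReal) (𝓝[>] t) (𝓝[>] 0) := by
    refine tendsto_nhdsWithin_iff.2 ⟨?_, ?_⟩
    · have hcont : Continuous fun s : ℝ => (s - t).toNNReal := by fun_prop
      simpa using (hcont.tendsto t).mono_left nhdsWithin_le_nhds
    · filter_upwards [self_mem_nhdsWithin] with s hs
      simpa using hs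
  refine (hzero.comp hsub).congr' ?_
  filter_upwards [self_mem_nhdsWithin] with s hs
  have hst : 0 ≤ s - t := sub_nonneg.2 (le_of_lt hs)
  have hadd : s.toNNReal = (s - t).toNNReal + t.toNNReal := by
    rw [← Real.toNNReal_add hst ht, sub_add_cancel]
  rw [slope_def_module, Function.comp_apply, Real.coe_toNNReal _ hst, hadd, hT.add,
    ContinuousLinearMap.comp_apply, RCLike.real_smul_eq_coe_smul (K := 𝕜)]

theorem IsGenerator.unique (hdense : Dense (A.domain : Set E)) (hT : IsC0ContractionSemigroup T)
    (hT' : IsC0ContractionSemigroup T') (hAT : IsGenerator A T) (hAT' : IsGenerator A T') :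
    T = T' := by
  refine funext fun t => DFunLike.coe_injective
    (Continuous.ext_on hdense (T t).continuous (T' t).continuous fun x hx => ?_)
  have hxy := A.mem_graph ⟨x, hx⟩
  have hmem (s : ℝ) := A.graph.sub_mem (hAT.mem_graph hT hxy s.toNNReal)
    (hAT'.mem_graph hT' hxy s.toNNReal)
  have hle := (hAT.isDissipative hT).norm_le_of_hasDerivWithinAt
    ((hT.continuous_toNNReal x).sub (hT'.continuous_toNNReal x))
    ((hT.continuous_toNNReal _).sub (hT'.continuous_toNNReal _))
    (fun s hs => (hAT.hasDerivWithinAt hT hxy hs).sub (hAT'.hasDerivWithinAt hT' hxy hs))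
    (fun s _ => hmem s) t.2
  simpa [hT.zero, hT'.zero, sub_eq_zero] using hle

theorem IsGenerator.functional_invariant (hdense : Dense (A.domain : Set E))
    (hT : IsC0ContractionSemigroup T) (hA : IsGenerator A T) (φ : E →L[𝕜] 𝕜)
    (hφ : ∀ x y, (x, y) ∈ A.graph → φ y = 0) (t : ℝ≥0) (x : E) : φ (T t x) = φ x := by
  refine congrFun (Continuous.ext_on hdense (φ.continuous.comp (T t).continuous) φ.continuous
    fun z hz => ?_) x
  have hzw := A.mem_graph ⟨z, hz⟩
  have hderiv (s : ℝ) (hs : s ∈ Set.Ico 0 (t : ℝ)) :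
      HasDerivWithinAt (fun s : ℝ => φ (T s.toNNReal z)) 0 (Set.Ici s) s := by
    have h := (φ.restrictScalars ℝ).hasFDerivAt.comp_hasDerivWithinAt s
      (hA.hasDerivWithinAt hT hzw hs.1)
    rwa [ContinuousLinearMap.coe_restrictScalars', hφ _ _ (hA.mem_graph hT hzw _)] at h
  simpa [hT.zero] using constant_of_has_deriv_right_zero
    (φ.continuous.comp (hT.continuous_toNNReal z)).continuousOn hderiv t (Set.right_mem_Icc.2 t.2)

end Semigroup

section Resolvent

variable {𝕜 : Type*} [RCLike 𝕜] {E : Type*} [NormedAddCommGroup E] [NormedSpace 𝕜 E]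
  {G : Submodule 𝕜 (E × E)} {R S : E →L[𝕜] E} {c : ℝ}

/-- `R` is a two-sided inverse of `c - A`, where `G` is the graph of `A`. -/
structure IsResolvent (G : Submodule 𝕜 (E × E)) (c : ℝ) (R : E →L[𝕜] E) : Prop where
  mem : ∀ z, (R z, (c : 𝕜) • R z - z) ∈ G
  apply_sub : ∀ ⦃x y⦄, (x, y) ∈ G → R ((c : 𝕜) • x - y) = x

theorem IsDissipative.exists_isResolvent (hG : IsDissipative G) (hc : 0 < c)
    (hsurj : Function.Surjective (shift G c)) : ∃ R, IsResolvent G c R := by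
  let e : G ≃ₗ[𝕜] E := LinearEquiv.ofBijective (shift G c).toLinearMap
    ⟨(hG.antilipschitz_shift hc).injective, hsurj⟩
  have he (z : E) : (c : 𝕜) • (e.symm z).1.1 - (e.symm z).1.2 = z := e.apply_symm_apply z
  have hnorm (z : E) : ‖(e.symm z).1.1‖ ≤ c⁻¹ * ‖z‖ := by
    rw [inv_mul_eq_div, le_div_iff₀' hc]
    exact (hG hc (e.symm z).2).trans_eq (by rw [he])
  refine ⟨((LinearMap.fst 𝕜 E E ∘ₗ G.subtype) ∘ₗ e.symm.toLinearMap).mkContinuous c⁻¹ hnorm,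
    fun z => ?_, fun x y hxy => ?_⟩
  · change ((e.symm z).1.1, (c : 𝕜) • (e.symm z).1.1 - z) ∈ G
    have hsnd : (c : 𝕜) • (e.symm z).1.1 - z = (e.symm z).1.2 := by
      rw [sub_eq_iff_eq_add, ← sub_eq_iff_eq_add', he]
    rw [hsnd]
    exact (e.symm z).2
  · exact congrArg (fun p : G => p.1.1) (e.symm_apply_apply ⟨(x, y), hxy⟩)

theorem IsResolvent.mul_norm_le (hR : IsResolvent G c R) (hG : IsDissipative G) (hc : 0 < c)
    (z : E) : c * ‖R z‖ ≤ ‖z‖ := by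
  simpa using hG hc (hR.mem z)

theorem IsResolvent.smul_apply_sub (hR : IsResolvent G c R) {x y : E} (hxy : (x, y) ∈ G) :
    (c : 𝕜) • R x - x = R y := by
  nth_rewrite 2 [← hR.apply_sub hxy]
  rw [map_sub, map_smul, sub_sub_cancel]

theorem IsResolvent.unique (hR : IsResolvent G c R) (hS : IsResolvent G c S) : R = S := by
  refine ContinuousLinearMap.ext fun z => ?_
  simpa using (hS.apply_sub (hR.mem z)).symm

theorem IsResolvent.commute {e : ℝ} (hR : IsResolvent G c R) (hS : IsResolvent G e S) :
    Commute R S := by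
  obtain rfl | hce := eq_or_ne c e
  · rw [hR.unique hS]
  refine ContinuousLinearMap.ext fun z => ?_
  change R (S z) = S (R z)
  have hRS := hR.smul_apply_sub (hS.mem z)
  have hSR := hS.smul_apply_sub (hR.mem z)
  rw [map_sub, map_smul] at hRS hSR
  have hzero : ((c : 𝕜) - e) • (R (S z) - S (R z)) = 0 := by
    rw [← sub_eq_zero] at hRS hSR
    calc ((c : 𝕜) - e) • (R (S z) - S (R z))
        = ((c : 𝕜) • R (S z) - S z - ((e : 𝕜) • R (S z) - R z))
          + ((e : 𝕜) • S (R z) - R z - ((c : 𝕜) • S (R z) - S z)) := by module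
      _ = 0 := by rw [hRS, hSR, add_zero]
  refine sub_eq_zero.1 ((smul_eq_zero.1 hzero).resolve_left (sub_ne_zero.2 ?_))
  exact fun h => hce (RCLike.ofReal_inj.1 h)

theorem tendsto_smul_resolvent {A : E →ₗ.[𝕜] E} (hA : IsDissipative A.graph)
    (hdense : Dense (A.domain : Set E)) {c : ℕ → ℝ} (hc : ∀ n, 0 < c n)
    (hctop : Tendsto c atTop atTop) {R : ℕ → E →L[𝕜] E}
    (hR : ∀ n, IsResolvent A.graph (c n) (R n)) (x : E) :
    Tendsto (fun n => (c n : 𝕜) • R n x) atTop (𝓝 x) := by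
  have hbound (n : ℕ) (z : E) : ‖(c n : 𝕜) • R n z‖ ≤ ‖z‖ := by
    rw [norm_smul, RCLike.norm_ofReal, abs_of_pos (hc n)]
    exact (hR n).mul_norm_le hA (hc n) z
  refine tendsto_apply_of_dense (F := fun n => (c n : 𝕜) • R n) (G := ContinuousLinearMap.id 𝕜 E)
    (C := 1) (fun n => ContinuousLinearMap.opNorm_le_bound _ zero_le_one
      fun z => by simpa using hbound n z) hdense (fun z hz => ?_) x
  obtain ⟨w, hzw⟩ : ∃ w, (z, w) ∈ A.graph := ⟨_, A.mem_graph ⟨z, hz⟩⟩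
  have hlim : Tendsto (fun n => ‖w‖ / c n) atTop (𝓝 0) := tendsto_const_nhds.div_atTop hctop
  refine tendsto_iff_norm_sub_tendsto_zero.2
    (squeeze_zero (fun _ => norm_nonneg _) (fun n => ?_) hlim)
  rw [smul_apply, ContinuousLinearMap.id_apply, (hR n).smul_apply_sub hzw, le_div_iff₀' (hc n)]
  exact (hR n).mul_norm_le hA (hc n) _

/-- The Yosida approximation `c (c R - 1)` of an operator with resolvent `R` at `c`. -/
def yosida (R : E →L[𝕜] E) (c : ℝ) : E →L[𝕜] E := (c : 𝕜) • ((c : 𝕜) • R - 1)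

theorem yosida_apply (R : E →L[𝕜] E) (c : ℝ) (x : E) :
    yosida R c x = (c : 𝕜) • ((c : 𝕜) • R x - x) := rfl

theorem IsResolvent.commute_yosida {e : ℝ} (hR : IsResolvent G c R) (hS : IsResolvent G e S) :
    Commute (yosida R c) (yosida S e) := by
  have h : Commute ((c : 𝕜) • R - 1) ((e : 𝕜) • S - 1) :=
    (((hR.commute hS).smul_left _ |>.smul_right _).sub_right (Commute.one_right _)).sub_left
      (Commute.one_left _)
  exact (h.smul_left _).smul_right _

theorem isDissipative_graph_yosida (hc : 0 < c) (hR : ∀ z, c * ‖R z‖ ≤ ‖z‖) :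
    IsDissipative (yosida R c).toLinearMap.graph := by
  rintro e he x y (rfl : y = yosida R c x)
  have hnorm : ‖((c * c : ℝ) : 𝕜) • R x‖ ≤ c * ‖x‖ := by
    rw [norm_smul, RCLike.norm_ofReal, abs_of_pos (mul_pos hc hc), mul_assoc]
    exact mul_le_mul_of_nonneg_left (hR x) hc.le
  calc e * ‖x‖ = ‖((e + c : ℝ) : 𝕜) • x‖ - c * ‖x‖ := by
        rw [norm_smul, RCLike.norm_ofReal, abs_of_pos (add_pos he hc)]
        ring
    _ ≤ ‖((e + c : ℝ) : 𝕜) • x - ((c * c : ℝ) : 𝕜) • R x‖ := by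
        linarith [norm_sub_norm_le (((e + c : ℝ) : 𝕜) • x) (((c * c : ℝ) : 𝕜) • R x)]
    _ = ‖(e : 𝕜) • x - yosida R c x‖ := by
        rw [yosida_apply]
        congr 1
        push_cast
        module

theorem tendsto_yosida_apply {A : E →ₗ.[𝕜] E} (hA : IsDissipative A.graph)
    (hdense : Dense (A.domain : Set E)) {c : ℕ → ℝ} (hc : ∀ n, 0 < c n)
    (hctop : Tendsto c atTop atTop) {R : ℕ → E →L[𝕜] E}
    (hR : ∀ n, IsResolvent A.graph (c n) (R n)) {x y : E} (hxy : (x, y) ∈ A.graph) :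
    Tendsto (fun n => yosida (R n) (c n) x) atTop (𝓝 y) := by
  simpa only [yosida_apply, (hR _).smul_apply_sub hxy] using
    tendsto_smul_resolvent hA hdense hc hctop hR y

end Resolvent

section Exponential

variable {𝕜 : Type*} [RCLike 𝕜] {E : Type*} [NormedAddCommGroup E] [NormedSpace 𝕜 E]
  {B C : E →L[𝕜] E}

/-- The group `exp (t B)`, with real `t`. -/
def expGroup (B : E →L[𝕜] E) (t : ℝ) : E →L[𝕜] E := NormedSpace.exp ((t : 𝕜) • B)

theorem expGroup_zero (B : E →L[𝕜] E) : expGroup B 0 = 1 := by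
  rw [expGroup, RCLike.ofReal_zero, zero_smul, NormedSpace.exp_zero]

theorem zero_expGroup (t : ℝ) : expGroup (0 : E →L[𝕜] E) t = 1 := by
  rw [expGroup, smul_zero, NormedSpace.exp_zero]

theorem expGroup_apply_comm (hBC : Commute B C) (t : ℝ) (x : E) :
    expGroup B t (C x) = C (expGroup B t x) :=
  DFunLike.congr_fun (hBC.smul_left (t : 𝕜)).exp_left x

variable [CompleteSpace E]

theorem expGroup_mul_expGroup (hBC : Commute B C) (s t : ℝ) :
    expGroup B s * expGroup C t = NormedSpace.exp ((s : 𝕜) • B + (t : 𝕜) • C) := by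
  let _ : NormedAlgebra ℚ (E →L[𝕜] E) := NormedAlgebra.restrictScalars ℚ 𝕜 _
  exact (NormedSpace.exp_add_of_commute ((hBC.smul_left _).smul_right _)).symm

theorem expGroup_add (B : E →L[𝕜] E) (s t : ℝ) :
    expGroup B (s + t) = (expGroup B s).comp (expGroup B t) := by
  rw [← ContinuousLinearMap.mul_def, expGroup_mul_expGroup (Commute.refl B), ← add_smul,
    ← RCLike.ofReal_add, expGroup]

variable [NormedSpace ℝ E] [IsScalarTower ℝ 𝕜 E]

theorem hasDerivAt_expGroup_apply (B : E →L[𝕜] E) (x : E) (t : ℝ) :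
    HasDerivAt (fun s : ℝ => expGroup B s x) (expGroup B t (B x)) t := by
  have h := (hasDerivAt_exp_smul_const B (t : 𝕜)).clm_apply (hasDerivAt_const (t : 𝕜) x)
  simpa [Function.comp_def, expGroup] using
    h.scomp t (RCLike.ofRealCLM (K := 𝕜)).hasDerivAt

theorem continuous_expGroup_apply (B : E →L[𝕜] E) (x : E) :
    Continuous fun s : ℝ => expGroup B s x :=
  continuous_iff_continuousAt.2 fun s => (hasDerivAt_expGroup_apply B x s).continuousAt

theorem norm_expGroup_apply_le (hB : IsDissipative B.toLinearMap.graph) {t : ℝ} (ht : 0 ≤ t)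
    (x : E) : ‖expGroup B t x‖ ≤ ‖x‖ := by
  simpa [expGroup_zero] using hB.norm_le_of_hasDerivWithinAt (continuous_expGroup_apply B x)
    (continuous_expGroup_apply B (B x))
    (fun s _ => (hasDerivAt_expGroup_apply B x s).hasDerivWithinAt)
    (fun s _ => expGroup_apply_comm (Commute.refl B) s x) ht

theorem norm_expGroup_sub_le (hB : IsDissipative B.toLinearMap.graph)
    (hC : IsDissipative C.toLinearMap.graph) (hBC : Commute B C) {t : ℝ} (ht : 0 ≤ t) (x : E) :
    ‖expGroup B t x - expGroup C t x‖ ≤ ‖B x - C x‖ * t := by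
  have hprod (s : ℝ) (z : E) :
      expGroup (B - C) s (expGroup C t z) = expGroup B s (expGroup C (t - s) z) := by
    have hBCC : Commute (B - C) C := hBC.sub_left (Commute.refl C)
    refine DFunLike.congr_fun (f := expGroup (B - C) s * expGroup C t)
      (g := expGroup B s * expGroup C (t - s)) ?_ z
    rw [expGroup_mul_expGroup hBCC, expGroup_mul_expGroup hBC]
    congr 1
    push_cast
    module
  have hderiv (s : ℝ) : HasDerivAt (fun s => expGroup (B - C) s (expGroup C t x))
      (expGroup B s (expGroup C (t - s) (B x - C x))) s := by
    convert hasDerivAt_expGroup_apply (B - C) (expGroup C t x) s using 1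
    rw [← hprod, ← sub_apply, expGroup_apply_comm (hBC.symm.sub_right (Commute.refl C))]
  simpa [hprod, expGroup_zero] using norm_image_sub_le_of_norm_deriv_le_segment'
    (fun s _ => (hderiv s).hasDerivWithinAt)
    (fun s hs => (norm_expGroup_apply_le hB hs.1 _).trans
      (norm_expGroup_apply_le hC (sub_nonneg.2 hs.2.le) _)) t (Set.right_mem_Icc.2 ht)

theorem norm_expGroup_sub_id_sub_smul_le (hB : IsDissipative B.toLinearMap.graph) {t : ℝ}
    (ht : 0 ≤ t) (x z : E) :
    ‖expGroup B t x - x - t • z‖ ≤ (‖B x - z‖ + ‖B z‖ * t) * t := by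
  have hzero : IsDissipative (0 : E →L[𝕜] E).toLinearMap.graph := by
    rintro c hc x y (rfl : y = 0)
    simp [norm_smul, abs_of_pos hc]
  have hderiv (s : ℝ) : HasDerivAt (fun s : ℝ => expGroup B s x - s • z)
      (expGroup B s (B x - z) + (expGroup B s z - z)) s := by
    refine ((hasDerivAt_expGroup_apply B x s).fun_sub
      ((hasDerivAt_id s).smul_const z)).congr_deriv ?_
    rw [map_sub, one_smul, sub_add_sub_cancel]
  have hbound (s : ℝ) (hs : s ∈ Set.Ico 0 t) :
      ‖expGroup B s (B x - z) + (expGroup B s z - z)‖ ≤ ‖B x - z‖ + ‖B z‖ * t := by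
    refine (norm_add_le _ _).trans (add_le_add (norm_expGroup_apply_le hB hs.1 _) ?_)
    have h := norm_expGroup_sub_le hB hzero (Commute.zero_right B) hs.1 z
    rw [zero_expGroup, zero_apply, sub_zero, one_apply_eq_self] at h
    exact h.trans (mul_le_mul_of_nonneg_left hs.2.le (norm_nonneg _))
  simpa [expGroup_zero, sub_right_comm] using norm_image_sub_le_of_norm_deriv_le_segment'
    (fun s _ => (hderiv s).hasDerivWithinAt) hbound t (Set.right_mem_Icc.2 ht)

end Exponential

section Generation

variable {𝕜 : Type*} [RCLike 𝕜] {E : Type*} [NormedAddCommGroup E] [NormedSpace 𝕜 E]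
  [NormedSpace ℝ E] [IsScalarTower ℝ 𝕜 E] [CompleteSpace E] {A : E →ₗ.[𝕜] E} {B : ℕ → E →L[𝕜] E}
  {T : ℝ≥0 → E →L[𝕜] E}

theorem cauchySeq_expGroup_apply (hB : ∀ n, IsDissipative (B n).toLinearMap.graph)
    (hcomm : ∀ m n, Commute (B m) (B n)) {t : ℝ} (ht : 0 ≤ t) {x : E}
    (hx : CauchySeq fun n => B n x) : CauchySeq fun n => expGroup (B n) t x := by
  rw [cauchySeq_iff_tendsto_dist_atTop_0] at hx ⊢
  refine squeeze_zero (fun _ => dist_nonneg) (fun p => ?_) (by simpa using hx.mul_const t)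
  rw [dist_eq_norm, dist_eq_norm]
  exact norm_expGroup_sub_le (hB p.1) (hB p.2) (hcomm p.1 p.2) ht x

theorem exists_tendsto_expGroup (hB : ∀ n, IsDissipative (B n).toLinearMap.graph)
    (hcomm : ∀ m n, Commute (B m) (B n)) (hdense : Dense (A.domain : Set E))
    (hlim : ∀ x y, (x, y) ∈ A.graph → Tendsto (fun n => B n x) atTop (𝓝 y)) (t : ℝ≥0) :
    ∃ S : E →L[𝕜] E, ‖S‖ ≤ 1 ∧ ∀ x, Tendsto (fun n => expGroup (B n) t x) atTop (𝓝 (S x)) :=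
  exists_tendsto_apply_of_dense
    (fun n => ContinuousLinearMap.opNorm_le_bound _ zero_le_one fun x => by
      simpa using norm_expGroup_apply_le (hB n) t.2 x) hdense
    fun x hx => cauchySeq_expGroup_apply hB hcomm t.2
      (hlim x _ (A.mem_graph ⟨x, hx⟩)).cauchySeq

theorem norm_sub_id_sub_smul_le_of_tendsto (hB : ∀ n, IsDissipative (B n).toLinearMap.graph)
    (hlim : ∀ x y, (x, y) ∈ A.graph → Tendsto (fun n => B n x) atTop (𝓝 y))
    (hT : ∀ t x, Tendsto (fun n => expGroup (B n) (t : ℝ≥0) x) atTop (𝓝 (T t x))) {x y z w : E}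
    (hxy : (x, y) ∈ A.graph) (hzw : (z, w) ∈ A.graph) (t : ℝ≥0) :
    ‖T t x - x - (t : ℝ) • z‖ ≤ (‖y - z‖ + ‖w‖ * t) * t :=
  le_of_tendsto_of_tendsto' (((hT t x).sub_const x).sub_const _).norm
    ((((hlim x y hxy).sub_const z).norm.add ((hlim z w hzw).norm.mul_const _)).mul_const _)
    fun n => norm_expGroup_sub_id_sub_smul_le (hB n) t.2 x z

theorem isC0ContractionSemigroup_of_tendsto_expGroup
    (hB : ∀ n, IsDissipative (B n).toLinearMap.graph) (hdense : Dense (A.domain : Set E))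
    (hlim : ∀ x y, (x, y) ∈ A.graph → Tendsto (fun n => B n x) atTop (𝓝 y))
    (hT : ∀ t x, Tendsto (fun n => expGroup (B n) (t : ℝ≥0) x) atTop (𝓝 (T t x)))
    (hnorm : ∀ t, ‖T t‖ ≤ 1) : IsC0ContractionSemigroup T := by
  refine isC0ContractionSemigroup_of_tendsto_zero ?_ (fun s t => ?_) hnorm hdense fun x hx => ?_
  · refine ContinuousLinearMap.ext fun x => tendsto_nhds_unique (hT 0 x) ?_
    simp [expGroup_zero]
  · refine ContinuousLinearMap.ext fun x => tendsto_nhds_unique (hT (s + t) x) ?_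
    have hcontr (n : ℕ) : ‖expGroup (B n) s‖ ≤ 1 :=
      ContinuousLinearMap.opNorm_le_bound _ zero_le_one fun z => by
        simpa using norm_expGroup_apply_le (hB n) s.2 z
    simpa [expGroup_add] using tendsto_apply_apply_of_norm_le hcontr (hT s) (hT t x)
  · obtain ⟨y, hxy⟩ : ∃ y, (x, y) ∈ A.graph := ⟨_, A.mem_graph ⟨x, hx⟩⟩
    refine tendsto_iff_norm_sub_tendsto_zero.2 (squeeze_zero (fun _ => norm_nonneg _)
      (g := fun t : ℝ≥0 => ‖y‖ * t) (fun t => ?_) ?_)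
    · simpa using norm_sub_id_sub_smul_le_of_tendsto hB hlim hT hxy A.graph.zero_mem t
    · have hcont : Continuous fun t : ℝ≥0 => ‖y‖ * (t : ℝ) := by fun_prop
      simpa using hcont.tendsto 0

theorem tendsto_slope_of_tendsto_expGroup (hB : ∀ n, IsDissipative (B n).toLinearMap.graph)
    (hdense : Dense (A.domain : Set E))
    (hlim : ∀ x y, (x, y) ∈ A.graph → Tendsto (fun n => B n x) atTop (𝓝 y))
    (hT : ∀ t x, Tendsto (fun n => expGroup (B n) (t : ℝ≥0) x) atTop (𝓝 (T t x))) {x y : E}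
    (hxy : (x, y) ∈ A.graph) :
    Tendsto (fun t : ℝ≥0 => (((t : ℝ)⁻¹ : ℝ) : 𝕜) • (T t x - x)) (𝓝[>] 0) (𝓝 y) := by
  refine Metric.tendsto_nhds.2 fun ε hε => ?_
  obtain ⟨z, hz, hyz⟩ := Metric.dense_iff.1 hdense y (ε / 3) (by positivity)
  obtain ⟨w, hzw⟩ : ∃ w, (z, w) ∈ A.graph := ⟨_, A.mem_graph ⟨z, hyz⟩⟩
  rw [Metric.mem_ball, dist_eq_norm, norm_sub_rev] at hz
  have hsmall : ∀ᶠ t : ℝ≥0 in 𝓝[>] 0, ‖w‖ * t < ε / 3 := by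
    have hcont : Continuous fun t : ℝ≥0 => ‖w‖ * (t : ℝ) := by fun_prop
    exact ((hcont.tendsto 0).mono_left nhdsWithin_le_nhds).eventually_lt_const
      (by simpa using by positivity)
  filter_upwards [hsmall, self_mem_nhdsWithin] with t ht htpos
  have htpos : (0 : ℝ) < t := htpos
  have hslope : ‖(((t : ℝ)⁻¹ : ℝ) : 𝕜) • (T t x - x) - z‖ ≤ ‖y - z‖ + ‖w‖ * t := by
    have h : (((t : ℝ)⁻¹ : ℝ) : 𝕜) • (T t x - x) - z
        = (t : ℝ)⁻¹ • (T t x - x - (t : ℝ) • z) := by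
      rw [smul_sub _ _ ((t : ℝ) • z), inv_smul_smul₀ htpos.ne',
        RCLike.real_smul_eq_coe_smul (K := 𝕜)]
    rw [h, norm_smul, Real.norm_of_nonneg (by positivity), inv_mul_le_iff₀' htpos]
    exact norm_sub_id_sub_smul_le_of_tendsto hB hlim hT hxy hzw t
  rw [dist_eq_norm, ← sub_sub_sub_cancel_right _ y z]
  linarith [norm_sub_le ((((t : ℝ)⁻¹ : ℝ) : 𝕜) • (T t x - x) - z) (y - z)]

/-- The **Hille–Yosida theorem**. -/
theorem IsMDissipative.exists_semigroup (hA : IsMDissipative A) :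
    ∃ T : ℝ≥0 → E →L[𝕜] E, IsC0ContractionSemigroup T ∧ IsGenerator A T := by
  let c (n : ℕ) : ℝ := n + 1
  have hc (n : ℕ) : 0 < c n := n.cast_add_one_pos
  have hctop : Tendsto c atTop atTop :=
    tendsto_atTop_add_const_right _ _ tendsto_natCast_atTop_atTop
  choose R hR using fun n =>
    hA.isDissipative.exists_isResolvent (hc n) (hA.surjective_shift (hc n))
  have hB (n : ℕ) : IsDissipative (yosida (R n) (c n)).toLinearMap.graph :=
    isDissipative_graph_yosida (hc n) ((hR n).mul_norm_le hA.isDissipative (hc n))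
  have hlim (x y : E) (hxy : (x, y) ∈ A.graph) :
      Tendsto (fun n => yosida (R n) (c n) x) atTop (𝓝 y) :=
    tendsto_yosida_apply hA.isDissipative hA.dense hc hctop hR hxy
  choose T hnorm hT using fun t =>
    exists_tendsto_expGroup hB (fun m n => (hR m).commute_yosida (hR n)) hA.dense hlim t
  exact ⟨T, isC0ContractionSemigroup_of_tendsto_expGroup hB hA.dense hlim hT hnorm,
    isGenerator_of_surjective_shift (hA.surjective_shift one_pos) hnorm
      fun x y => tendsto_slope_of_tendsto_expGroup hB hA.dense hlim hT⟩

end Generation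

section SelfAdjoint

variable {𝕜 : Type*} [RCLike 𝕜] {H : Type*} [NormedAddCommGroup H] [InnerProductSpace 𝕜 H]

theorem isDissipative_of_re_inner_nonpos {G : Submodule 𝕜 (H × H)}
    (h : ∀ x y, (x, y) ∈ G → RCLike.re (inner 𝕜 y x) ≤ 0) : IsDissipative G := by
  intro c _ x y hxy
  obtain rfl | hx := eq_or_ne x 0
  · simp
  refine le_of_mul_le_mul_right ?_ (norm_pos_iff.2 hx)
  calc c * ‖x‖ * ‖x‖ ≤ c * ‖x‖ * ‖x‖ - RCLike.re (inner 𝕜 y x) := by linarith [h x y hxy]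
    _ = RCLike.re (inner 𝕜 ((c : 𝕜) • x - y) x) := by
        rw [inner_sub_left, inner_smul_left, RCLike.conj_ofReal, map_sub, RCLike.re_ofReal_mul,
          inner_self_eq_norm_mul_norm, mul_assoc]
    _ ≤ ‖(c : 𝕜) • x - y‖ * ‖x‖ := re_inner_le_norm _ _

variable [CompleteSpace H] {A : H →ₗ.[𝕜] H}

theorem mem_graph_adjoint_iff (hA : Dense (A.domain : Set H)) {x y : H} :
    (x, y) ∈ A.adjoint.graph ↔ ∀ a b, (a, b) ∈ A.graph → inner 𝕜 b x = inner 𝕜 a y := by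
  rw [LinearPMap.adjoint_graph_eq_graph_adjoint hA, Submodule.mem_adjoint_iff]
  simp only [sub_eq_zero]

theorem denseRange_shift {G : Submodule 𝕜 (H × H)} {c : ℝ}
    (h : ∀ z, (∀ x y, (x, y) ∈ G → inner 𝕜 z ((c : 𝕜) • x - y) = 0) → z = 0) :
    DenseRange (shift G c) := by
  have hbot : (LinearMap.range (shift G c).toLinearMap)ᗮ = ⊥ :=
    (Submodule.eq_bot_iff _).2 fun z hz => h z fun x y hxy =>
      (Submodule.mem_orthogonal' _ _).1 hz _ ⟨⟨(x, y), hxy⟩, rfl⟩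
  exact Submodule.dense_iff_topologicalClosure_eq_top.2
    (Submodule.topologicalClosure_eq_top_iff.2 hbot)

theorem IsSymmetricOp.isClosable (hA : IsSymmetricOp A) : A.IsClosable :=
  (A.adjoint_isClosed hA.1).isClosable.leIsClosable hA.2

theorem adjoint_closure (hA : Dense (A.domain : Set H)) (hclosable : A.IsClosable) :
    A.closure.adjoint = A.adjoint := by
  refine LinearPMap.eq_of_eq_graph (SetLike.ext fun ⟨x, y⟩ => ?_)
  rw [mem_graph_adjoint_iff (hA.mono A.le_closure.1), mem_graph_adjoint_iff hA,
    ← hclosable.graph_closure_eq_closure_graph]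
  refine ⟨fun h a b hab => h a b (Submodule.le_topologicalClosure _ hab), fun h a b hab => ?_⟩
  have hclosed : IsClosed {p : H × H | inner 𝕜 p.2 x = inner 𝕜 p.1 y} :=
    isClosed_eq (by fun_prop) (by fun_prop)
  exact closure_minimal (fun p hp => h p.1 p.2 hp) hclosed hab

theorem IsSymmetricOp.closure (hA : IsSymmetricOp A) : IsSymmetricOp A.closure := by
  refine ⟨hA.1.mono A.le_closure.1, LinearPMap.le_graph_iff.1 ?_⟩
  rw [adjoint_closure hA.1 hA.isClosable, ← hA.isClosable.graph_closure_eq_closure_graph]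
  exact Submodule.topologicalClosure_minimal _ (LinearPMap.le_graph_of_le hA.2)
    (A.adjoint_isClosed hA.1)

theorem IsSymmetricOp.isSelfAdjoint (hA : IsSymmetricOp A) {c : ℝ}
    (hsurj : Function.Surjective (shift A.graph c)) : IsSelfAdjoint A := by
  rw [LinearPMap.isSelfAdjoint_def]
  refine le_antisymm (LinearPMap.le_graph_iff.1 ?_) hA.2
  rintro ⟨u, w⟩ huw
  obtain ⟨⟨⟨v, z⟩, hvz⟩, hv⟩ := hsurj ((c : 𝕜) • u - w)
  have hdiff : (u - v, w - z) ∈ A.adjoint.graph :=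
    A.adjoint.graph.sub_mem huw (LinearPMap.le_graph_of_le hA.2 hvz)
  have hwz : w - z = (c : 𝕜) • (u - v) := by
    rw [smul_sub]
    exact (sub_eq_sub_iff_sub_eq_sub.1 hv.symm).symm
  obtain ⟨⟨⟨a, b⟩, hab⟩, ha⟩ := hsurj (u - v)
  have huv : inner 𝕜 (u - v) (u - v) = 0 := by
    nth_rewrite 1 [← ha]
    rw [shift_apply, inner_sub_left, (mem_graph_adjoint_iff hA.1).1 hdiff a b hab, hwz,
      inner_smul_left, inner_smul_right, RCLike.conj_ofReal, sub_self]
  rw [inner_self_eq_zero, sub_eq_zero] at huv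
  rw [huv, sub_self, smul_zero, sub_eq_zero] at hwz
  rwa [huv, hwz]

end SelfAdjoint

section SchwartzCalculus

variable {𝕜 : Type*} [RCLike 𝕜] {V : Type*} [NormedAddCommGroup V] [NormedSpace ℝ V]

/-- Complex conjugation of Schwartz functions. -/
def schwartzConj (f : 𝓢(V, 𝕜)) : 𝓢(V, 𝕜) :=
  SchwartzMap.postcompCLM (RCLike.conjCLE (K := 𝕜) : 𝕜 →L[ℝ] 𝕜) f

theorem schwartzConj_apply (f : 𝓢(V, 𝕜)) (x : V) : schwartzConj f x = starRingEnd 𝕜 (f x) := rfl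

theorem schwartzConj_schwartzConj (f : 𝓢(V, 𝕜)) : schwartzConj (schwartzConj f) = f := by
  ext x
  rw [schwartzConj_apply, schwartzConj_apply, RCLike.conj_conj]

theorem lineDerivOp_schwartzConj (v : V) (f : 𝓢(V, 𝕜)) :
    ∂_{v} (schwartzConj f) = schwartzConj (∂_{v} f) := by
  ext x
  have h := ((RCLike.conjCLE (K := 𝕜) : 𝕜 →L[ℝ] 𝕜).hasFDerivAt.comp x (f.hasFDerivAt x)).fderiv
  rw [SchwartzMap.lineDerivOp_apply_eq_fderiv, schwartzConj_apply,
    SchwartzMap.lineDerivOp_apply_eq_fderiv]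
  exact DFunLike.congr_fun h v

theorem lineDerivOp_smulLeftCLM_apply {p : V → 𝕜} (hp : p.HasTemperateGrowth) (v : V)
    (f : 𝓢(V, 𝕜)) (x : V) :
    ∂_{v} (SchwartzMap.smulLeftCLM 𝕜 p f) x = fderiv ℝ p x v * f x + p x * ∂_{v} f x := by
  have hdiff : DifferentiableAt ℝ p x := (hp.1.differentiable (by simp)) x
  rw [SchwartzMap.lineDerivOp_apply_eq_fderiv, SchwartzMap.smulLeftCLM_apply hp,
    SchwartzMap.lineDerivOp_apply_eq_fderiv]
  change fderiv ℝ (p * ⇑f) x v = _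
  rw [fderiv_mul hdiff f.differentiableAt, add_apply, smul_apply, smul_apply, smul_eq_mul,
    smul_eq_mul, add_comm, mul_comm (f x)]

end SchwartzCalculus

section Coordinates

variable {𝕜 : Type*} [RCLike 𝕜] {d : ℕ}

/-- Multiplication of Schwartz functions by the `i`-th coordinate. -/
def coordMul (i : Fin d) : 𝓢(Rd d, 𝕜) →L[𝕜] 𝓢(Rd d, 𝕜) :=
  SchwartzMap.smulLeftCLM 𝕜 (fun x : Rd d => ((x i : ℝ) : 𝕜))

/-- The `i`-th coordinate, as a continuous linear map to `𝕜`. -/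
abbrev coordCLM (𝕜 : Type*) [RCLike 𝕜] (i : Fin d) : Rd d →L[ℝ] 𝕜 :=
  (RCLike.ofRealCLM (K := 𝕜)).comp (EuclideanSpace.proj i)

theorem coordMul_apply (i : Fin d) (f : 𝓢(Rd d, 𝕜)) (x : Rd d) :
    coordMul i f x = ((x i : ℝ) : 𝕜) * f x :=
  SchwartzMap.smulLeftCLM_apply_apply (coordCLM 𝕜 i).hasTemperateGrowth f x

theorem lineDerivOp_coordMul (i : Fin d) (f : 𝓢(Rd d, 𝕜)) :
    ∂_{basisVec i} (coordMul i f) = f + coordMul i (∂_{basisVec i} f) := by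
  ext x
  have h := lineDerivOp_smulLeftCLM_apply (coordCLM 𝕜 i).hasTemperateGrowth (basisVec i) f x
  rw [(coordCLM 𝕜 i).fderiv] at h
  refine h.trans ?_
  rw [add_apply, coordMul_apply]
  simp

theorem eulerOp_eq_sum (f : 𝓢(Rd d, 𝕜)) :
    eulerOp 𝕜 d f = ∑ i : Fin d, coordMul i (∂_{basisVec i} f) := by
  simp only [eulerOp, LinearMap.sum_apply]
  rfl

theorem lapOp_eq_laplacian (f : 𝓢(Rd d, 𝕜)) : lapOp 𝕜 d f = Δ f :=
  SchwartzMap.laplacianCLM_eq 𝕜 f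

theorem lapOp_eq_sum (f : 𝓢(Rd d, 𝕜)) :
    lapOp 𝕜 d f = ∑ i : Fin d, ∂_{basisVec i} (∂_{basisVec i} f) := by
  rw [lapOp_eq_laplacian, SchwartzMap.laplacian_eq_sum (EuclideanSpace.basisFun (Fin d) ℝ) f]
  simp only [EuclideanSpace.basisFun_apply]

theorem ouOp_eq_sum (f : 𝓢(Rd d, 𝕜)) : ouOp 𝕜 d f =
    ∑ i : Fin d, (∂_{basisVec i} (∂_{basisVec i} f) - coordMul i (∂_{basisVec i} f)) := by
  rw [Finset.sum_sub_distrib, ← lapOp_eq_sum, ← eulerOp_eq_sum]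
  rfl

theorem ouOp_schwartzConj (f : 𝓢(Rd d, 𝕜)) :
    ouOp 𝕜 d (schwartzConj f) = schwartzConj (ouOp 𝕜 d f) := by
  ext x
  simp only [ouOp_eq_sum, lineDerivOp_schwartzConj, schwartzConj_apply, sum_apply,
    sub_apply, coordMul_apply, map_sum, map_sub, map_mul, RCLike.conj_ofReal]

end Coordinates

section L2Pairing

variable {𝕜 : Type*} [RCLike 𝕜] {d : ℕ} (ν : Measure (Rd d)) [ν.HasTemperateGrowth]

/-- The bilinear pairing `∫ g φ dν` of a function `g ∈ L²(ν)` with a Schwartz function `φ`. -/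
def l2Pairing (g : Lp 𝕜 2 ν) : 𝓢(Rd d, 𝕜) →ₗ[𝕜] 𝕜 where
  toFun φ := ∫ x, g x * φ x ∂ν
  map_add' φ ψ := by
    simp only [add_apply, mul_add]
    exact integral_add ((Lp.memLp g).integrable_mul (φ.memLp 2 ν))
      ((Lp.memLp g).integrable_mul (ψ.memLp 2 ν))
  map_smul' c φ := by
    simp only [smul_apply, smul_eq_mul, RingHom.id_apply, mul_left_comm _ c, integral_const_mul]

theorem l2Pairing_apply (g : Lp 𝕜 2 ν) (φ : 𝓢(Rd d, 𝕜)) :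
    l2Pairing ν g φ = ∫ x, g x * φ x ∂ν := rfl

theorem l2Pairing_schwartzToL2 (f φ : 𝓢(Rd d, 𝕜)) :
    l2Pairing ν (schwartzToL2 ν f) φ = ∫ x, f x * φ x ∂ν := by
  refine integral_congr_ae ?_
  filter_upwards [f.coeFn_toLp 2 ν] with x hx
  exact congrArg (· * φ x) hx

theorem l2Pairing_schwartzToL2_comm (f φ : 𝓢(Rd d, 𝕜)) :
    l2Pairing ν (schwartzToL2 ν f) φ = l2Pairing ν (schwartzToL2 ν φ) f := by
  simp only [l2Pairing_schwartzToL2, mul_comm]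

theorem inner_schwartzToL2_left (f : 𝓢(Rd d, 𝕜)) (g : Lp 𝕜 2 ν) :
    inner 𝕜 (schwartzToL2 ν f) g = l2Pairing ν g (schwartzConj f) := by
  rw [L2.inner_def]
  refine integral_congr_ae ?_
  filter_upwards [f.coeFn_toLp 2 ν] with x hx
  exact congrArg (g x * starRingEnd 𝕜 ·) hx

variable [ν.IsOpenPosMeasure] {A A' : 𝓢(Rd d, 𝕜) →ₗ[𝕜] 𝓢(Rd d, 𝕜)}

theorem mem_graph_onSchwartz_iff {a b : Lp 𝕜 2 ν} :
    (a, b) ∈ (onSchwartz ν A).graph ↔ ∃ f, schwartzToL2 ν f = a ∧ schwartzToL2 ν (A f) = b := by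
  rw [LinearPMap.mem_graph_iff]
  constructor
  · rintro ⟨⟨y, f, rfl⟩, rfl, rfl⟩
    exact ⟨f, rfl, (onSchwartz_apply ν A f).symm⟩
  · rintro ⟨f, rfl, rfl⟩
    exact ⟨⟨_, f, rfl⟩, rfl, onSchwartz_apply ν A f⟩

variable [IsFiniteMeasureOnCompacts ν]

theorem dense_domain_onSchwartz (A : 𝓢(Rd d, 𝕜) →ₗ[𝕜] 𝓢(Rd d, 𝕜)) :
    Dense ((onSchwartz ν A).domain : Set (Lp 𝕜 2 ν)) :=
  SchwartzMap.denseRange_toLpCLM (E := Rd d) (F := 𝕜) (p := 2) (μ := ν) (by simp)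

theorem mem_graph_adjoint_onSchwartz_iff
    (hA : ∀ f, A (schwartzConj f) = schwartzConj (A f)) {g h : Lp 𝕜 2 ν} :
    (g, h) ∈ (onSchwartz ν A).adjoint.graph ↔ ∀ φ, l2Pairing ν g (A φ) = l2Pairing ν h φ := by
  rw [mem_graph_adjoint_iff (dense_domain_onSchwartz ν A)]
  constructor
  · intro H φ
    have hφ := H _ _ ((mem_graph_onSchwartz_iff ν).2 ⟨schwartzConj φ, rfl, rfl⟩)
    rwa [inner_schwartzToL2_left, inner_schwartzToL2_left, ← hA,
      schwartzConj_schwartzConj] at hφ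
  · intro H a b hab
    obtain ⟨f, rfl, rfl⟩ := (mem_graph_onSchwartz_iff ν).1 hab
    rw [inner_schwartzToL2_left, inner_schwartzToL2_left, ← hA]
    exact H _

theorem onSchwartz_le_adjoint (hA : ∀ f, A (schwartzConj f) = schwartzConj (A f))
    (h : ∀ f φ, l2Pairing ν (schwartzToL2 ν f) (A φ) = l2Pairing ν (schwartzToL2 ν φ) (A' f)) :
    onSchwartz ν A' ≤ (onSchwartz ν A).adjoint := by
  refine LinearPMap.le_graph_iff.1 ?_
  rintro ⟨a, b⟩ hab
  obtain ⟨f, rfl, rfl⟩ := (mem_graph_onSchwartz_iff ν).1 hab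
  exact (mem_graph_adjoint_onSchwartz_iff ν hA).2 fun φ =>
    (h f φ).trans (l2Pairing_schwartzToL2_comm ν φ (A' f))

end L2Pairing

section Lebesgue

variable {𝕜 : Type*} [RCLike 𝕜] {d : ℕ}

theorem solvesDualWeakly_iff {g h : Lp 𝕜 2 (volume : Measure (Rd d))} :
    SolvesDualWeakly g h ↔ ∀ φ, l2Pairing volume g (ouOp 𝕜 d φ) = l2Pairing volume h φ := by
  refine forall_congr' fun φ => ?_
  have hlap : ∫ x, g x * Δ (φ : Rd d → 𝕜) x = l2Pairing volume g (lapOp 𝕜 d φ) := by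
    simp only [l2Pairing_apply, lapOp_apply]
  have hderiv (i : Fin d) :
      ∫ x, g x * lineDeriv ℝ (fun y : Rd d => ((y i : ℝ) : 𝕜) * φ y) x (basisVec i)
        = l2Pairing volume g (φ + coordMul i (∂_{basisVec i} φ)) := by
    simp only [← lineDerivOp_coordMul, l2Pairing_apply, SchwartzMap.lineDerivOp_apply,
      ← coordMul_apply]
  simp only [hlap, hderiv, ← l2Pairing_apply, ouOp, LinearMap.sub_apply, eulerOp_eq_sum, map_add,
    map_sub, map_sum, Finset.sum_add_distrib, Finset.sum_const, Finset.card_univ,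
    Fintype.card_fin, nsmul_eq_mul]
  rw [← sub_sub, sub_add_eq_add_sub, sub_add_cancel]

theorem l2Pairing_eulerOp_volume (f φ : 𝓢(Rd d, 𝕜)) :
    l2Pairing volume (schwartzToL2 volume f) (eulerOp 𝕜 d φ)
      = -l2Pairing volume (schwartzToL2 volume φ) (eulerOp 𝕜 d f + (d : 𝕜) • f) := by
  have hparts (i : Fin d) : l2Pairing volume (schwartzToL2 volume f) (coordMul i (∂_{basisVec i} φ))
      = -l2Pairing volume (schwartzToL2 volume φ) (f + coordMul i (∂_{basisVec i} f)) := by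
    rw [← lineDerivOp_coordMul, l2Pairing_schwartzToL2_comm volume φ, l2Pairing_schwartzToL2,
      l2Pairing_schwartzToL2, ← SchwartzMap.integral_mul_lineDerivOp_right_eq_neg_left]
    simp only [coordMul_apply, mul_assoc, mul_left_comm]
  simp only [eulerOp_eq_sum, map_add, map_sum, map_smul, hparts, Finset.sum_neg_distrib,
    Finset.sum_add_distrib, Finset.sum_const, Finset.card_univ, Fintype.card_fin, nsmul_eq_mul,
    smul_eq_mul]
  rw [add_comm]

theorem onSchwartz_ouDualOp_le_adjoint :
    onSchwartz volume (ouDualOp 𝕜 d) ≤ (onSchwartz volume (ouOp 𝕜 d)).adjoint := by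
  refine onSchwartz_le_adjoint volume ouOp_schwartzConj fun f φ => ?_
  have hlap : l2Pairing volume (schwartzToL2 volume f) (lapOp 𝕜 d φ)
      = l2Pairing volume (schwartzToL2 volume φ) (lapOp 𝕜 d f) := by
    rw [l2Pairing_schwartzToL2_comm volume φ, l2Pairing_schwartzToL2, l2Pairing_schwartzToL2,
      lapOp_eq_laplacian, lapOp_eq_laplacian, SchwartzMap.integral_mul_laplacian_right_eq_left]
  have hdual : ouDualOp 𝕜 d f = lapOp 𝕜 d f + (eulerOp 𝕜 d f + (d : 𝕜) • f) := add_assoc _ _ _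
  rw [hdual, ouOp, LinearMap.sub_apply, map_sub, map_add, hlap, l2Pairing_eulerOp_volume,
    sub_neg_eq_add]

end Lebesgue

section Gauss

variable {𝕜 : Type*} [RCLike 𝕜] {d : ℕ}

theorem integral_gauss {E : Type*} [NormedAddCommGroup E] [NormedSpace ℝ E] (F : Rd d → E) :
    ∫ x, F x ∂(gauss d) = ∫ x, rho d x • F x := by
  rw [gauss, integral_withDensity_eq_integral_toReal_smul₀
    (continuous_rho d).measurable.ennreal_ofReal.aemeasurable
    (ae_of_all _ fun _ => ENNReal.ofReal_lt_top)]
  simp only [ENNReal.toReal_ofReal (rho_pos d _).le]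

theorem hasFDerivAt_rho (x : Rd d) : HasFDerivAt (rho d) (-rho d x • innerSL ℝ x) x := by
  have hsq : HasFDerivAt (fun y : Rd d => ‖y‖ ^ 2) (2 • innerSL ℝ x) x :=
    (hasStrictFDerivAt_norm_sq x).hasFDerivAt
  have hexp := (hsq.fun_neg.mul_const (2⁻¹ : ℝ)).exp.mul_const ((2 * Real.pi) ^ ((d : ℝ) / 2))⁻¹
  simp only [← div_eq_mul_inv] at hexp
  refine hexp.congr_fderiv ?_
  ext y
  simp [rho]
  ring

theorem rho_le (x : Rd d) : rho d x ≤ ((2 * Real.pi) ^ ((d : ℝ) / 2))⁻¹ := by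
  rw [rho, div_eq_mul_inv]
  refine mul_le_of_le_one_left (by positivity) (Real.exp_le_one_iff.2 ?_)
  linarith [sq_nonneg ‖x‖]

theorem integrable_rho_smul (f : 𝓢(Rd d, 𝕜)) : Integrable fun x => rho d x • f x := by
  refine f.integrable.bdd_smul ((2 * Real.pi) ^ ((d : ℝ) / 2))⁻¹
    (continuous_rho d).aestronglyMeasurable (ae_of_all _ fun x => ?_)
  rw [Real.norm_of_nonneg (rho_pos d x).le]
  exact rho_le x

theorem integral_lineDerivOp_gauss (i : Fin d) (f : 𝓢(Rd d, 𝕜)) :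
    ∫ x, (∂_{basisVec i} f) x ∂(gauss d) = ∫ x, coordMul i f x ∂(gauss d) := by
  have hrho (x : Rd d) : fderiv ℝ (rho d) x (basisVec i) • f x = -(rho d x • coordMul i f x) := by
    rw [(hasFDerivAt_rho x).fderiv, coordMul_apply, RCLike.real_smul_eq_coe_mul,
      RCLike.real_smul_eq_coe_mul]
    simp [EuclideanSpace.inner_single_right]
    ring
  have hparts := integral_smul_fderiv_eq_neg_fderiv_smul_of_integrable
    (μ := (volume : Measure (Rd d))) (f := rho d) (g := f) (v := basisVec i)
    (by simp only [hrho]; exact (integrable_rho_smul (coordMul i f)).neg)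
    (by simpa only [SchwartzMap.lineDerivOp_apply_eq_fderiv] using
      integrable_rho_smul (∂_{basisVec i} f)) (integrable_rho_smul f)
    (fun x _ => (hasFDerivAt_rho x).differentiableAt) (fun x _ => f.differentiableAt)
  simp only [hrho, integral_neg, neg_neg] at hparts
  simpa only [integral_gauss, SchwartzMap.lineDerivOp_apply_eq_fderiv] using hparts

theorem integral_ouOp_gauss (f : 𝓢(Rd d, 𝕜)) : ∫ x, ouOp 𝕜 d f x ∂(gauss d) = 0 := by
  simp only [ouOp_eq_sum, sum_apply]
  rw [integral_finsetSum _ fun i _ => SchwartzMap.integrable _]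
  refine Finset.sum_eq_zero fun i _ => ?_
  simp only [sub_apply]
  rw [integral_sub (SchwartzMap.integrable _) (SchwartzMap.integrable _),
    integral_lineDerivOp_gauss, sub_self]

theorem l2Pairing_adjointDeriv_gauss (i : Fin d) (f φ : 𝓢(Rd d, 𝕜)) :
    l2Pairing (gauss d) (schwartzToL2 _ f) (∂_{basisVec i} φ - coordMul i φ)
      = -l2Pairing (gauss d) (schwartzToL2 _ (∂_{basisVec i} f)) φ := by
  have hmul (u v : 𝓢(Rd d, 𝕜)) (x : Rd d) : SchwartzMap.smulLeftCLM 𝕜 u v x = u x * v x :=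
    SchwartzMap.smulLeftCLM_apply_apply u.hasTemperateGrowth v x
  have hint (u v : 𝓢(Rd d, 𝕜)) : Integrable (fun x => u x * v x) (gauss d) :=
    (SchwartzMap.integrable _).congr (ae_of_all _ (hmul u v))
  have hcoord (x : Rd d) : coordMul i (SchwartzMap.smulLeftCLM 𝕜 f φ) x = f x * coordMul i φ x := by
    rw [coordMul_apply, coordMul_apply, hmul, mul_left_comm]
  have hparts := integral_lineDerivOp_gauss i (SchwartzMap.smulLeftCLM 𝕜 f φ)
  simp only [lineDerivOp_smulLeftCLM_apply f.hasTemperateGrowth, hcoord,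
    ← SchwartzMap.lineDerivOp_apply_eq_fderiv] at hparts
  rw [integral_add (hint _ _) (hint _ _)] at hparts
  rw [map_sub, l2Pairing_schwartzToL2, l2Pairing_schwartzToL2, l2Pairing_schwartzToL2, ← hparts,
    sub_add_cancel_right]

theorem l2Pairing_ouOp_gauss (f φ : 𝓢(Rd d, 𝕜)) :
    l2Pairing (gauss d) (schwartzToL2 _ f) (ouOp 𝕜 d φ)
      = -∑ i : Fin d, ∫ x, ∂_{basisVec i} f x * ∂_{basisVec i} φ x ∂(gauss d) := by
  simp only [ouOp_eq_sum, map_sum, l2Pairing_adjointDeriv_gauss, Finset.sum_neg_distrib]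
  simp only [l2Pairing_schwartzToL2]

theorem isSymmetricOp_ouOp : IsSymmetricOp (onSchwartz (gauss d) (ouOp 𝕜 d)) :=
  ⟨dense_domain_onSchwartz _ _, onSchwartz_le_adjoint _ ouOp_schwartzConj fun f φ => by
    simp only [l2Pairing_ouOp_gauss, mul_comm]⟩

theorem isDissipative_ouOp : IsDissipative (onSchwartz (gauss d) (ouOp 𝕜 d)).graph := by
  refine isDissipative_of_re_inner_nonpos fun x y hxy => ?_
  obtain ⟨f, rfl, rfl⟩ := (mem_graph_onSchwartz_iff _).1 hxy
  have hsq (i : Fin d) (x : Rd d) : ∂_{basisVec i} f x * ∂_{basisVec i} (schwartzConj f) x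
      = ((‖∂_{basisVec i} f x‖ ^ 2 : ℝ) : 𝕜) := by
    rw [lineDerivOp_schwartzConj, schwartzConj_apply, RCLike.mul_conj, RCLike.ofReal_pow]
  simp only [inner_schwartzToL2_left, ← ouOp_schwartzConj, l2Pairing_ouOp_gauss, hsq,
    integral_ofReal, ← RCLike.ofReal_sum, ← RCLike.ofReal_neg, RCLike.ofReal_re, neg_nonpos]
  exact Finset.sum_nonneg fun i _ => integral_nonneg fun x => by positivity

theorem isOperatorInvariant_ouOp :
    IsOperatorInvariant (gauss d) (onSchwartz (gauss d) (ouOp 𝕜 d)) := by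
  refine ⟨dense_domain_onSchwartz _ _, ?_⟩
  rintro ⟨_, f, rfl⟩
  have hcoe : (schwartzToL2 (gauss d) (ouOp 𝕜 d f) : Rd d → 𝕜) =ᵐ[gauss d] ouOp 𝕜 d f :=
    (ouOp 𝕜 d f).coeFn_toLp 2 (gauss d)
  rw [onSchwartz_apply]
  exact ⟨(ouOp 𝕜 d f).integrable.congr hcoe.symm,
    (integral_congr_ae hcoe).trans (integral_ouOp_gauss f)⟩

end Gauss

section PlaneWaves

variable {𝕜 : Type*} [RCLike 𝕜] {V : Type*} [NormedAddCommGroup V] [InnerProductSpace ℝ V]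

/-- The real plane wave `x ↦ cos (⟪a, x⟫ + θ)` with frequency `a` and phase `θ`. Real waves are used
in place of characters so that real and complex scalars are treated alike. -/
def planeWave (𝕜 : Type*) [RCLike 𝕜] (a : V) (θ : ℝ) (x : V) : 𝕜 :=
  (Real.cos (inner ℝ a x + θ) : 𝕜)

@[fun_prop]
theorem continuous_planeWave (a : V) (θ : ℝ) : Continuous (planeWave 𝕜 a θ) := by
  unfold planeWave
  fun_prop

theorem norm_planeWave_le (a : V) (θ : ℝ) (x : V) : ‖planeWave 𝕜 a θ x‖ ≤ 1 := by
  rw [planeWave, RCLike.norm_ofReal]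
  exact Real.abs_cos_le_one _

theorem planeWave_add_pi_div_two_add_pi_div_two (a : V) (θ : ℝ) (x : V) :
    planeWave 𝕜 a (θ + Real.pi / 2 + Real.pi / 2) x = -planeWave 𝕜 a θ x := by
  rw [planeWave, add_assoc θ, add_halves, ← add_assoc, Real.cos_add_pi, RCLike.ofReal_neg]
  rfl

theorem hasFDerivAt_planeWave (a : V) (θ : ℝ) (x : V) : HasFDerivAt (planeWave 𝕜 a θ)
    ((innerSL ℝ a).smulRight (planeWave 𝕜 a (θ + Real.pi / 2) x)) x := by
  have h := (RCLike.ofRealCLM (K := 𝕜)).hasFDerivAt.comp x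
    (((innerSL ℝ a).hasFDerivAt (x := x)).add_const θ).cos
  refine h.congr_fderiv ?_
  ext v
  simp [planeWave, ← add_assoc, Real.cos_add_pi_div_two, RCLike.real_smul_eq_coe_mul, mul_comm]

theorem hasDerivAt_planeWave_smul (a : V) (θ r : ℝ) (x : V) :
    HasDerivAt (fun r : ℝ => planeWave 𝕜 (r • a) θ x)
      ((inner ℝ a x : ℝ) * planeWave 𝕜 (r • a) (θ + Real.pi / 2) x) r := by
  have hcomm (r : ℝ) (θ : ℝ) : planeWave 𝕜 (r • a) θ x = planeWave 𝕜 a θ (r • x) := by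
    rw [planeWave, planeWave, real_inner_smul_left, real_inner_smul_right]
  have hline : HasDerivAt (fun r : ℝ => r • x) x r := by
    simpa using (hasDerivAt_id r).smul_const x
  have h := (hasFDerivAt_planeWave (𝕜 := 𝕜) a θ (r • x)).comp_hasDerivAt r hline
  simp only [hcomm]
  refine h.congr_deriv ?_
  rw [ContinuousLinearMap.smulRight_apply, innerSL_apply_apply, RCLike.real_smul_eq_coe_mul]

theorem hasTemperateGrowth_cos : Real.cos.HasTemperateGrowth :=
  ⟨Real.contDiff_cos, fun n => ⟨0, 1, fun x => by
    rw [norm_iteratedFDeriv_eq_norm_iteratedDeriv, pow_zero, mul_one]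
    exact Real.abs_iteratedDeriv_cos_le_one n x⟩⟩

theorem hasTemperateGrowth_planeWave (a : V) (θ : ℝ) : (planeWave 𝕜 a θ).HasTemperateGrowth :=
  (Function.RCLike.hasTemperateGrowth_ofReal 𝕜).comp
    (hasTemperateGrowth_cos.comp (((innerSL ℝ a).hasTemperateGrowth).add (.const θ)))

/-- Multiplication of Schwartz functions by a plane wave. -/
def waveMul (a : V) (θ : ℝ) : 𝓢(V, 𝕜) →L[𝕜] 𝓢(V, 𝕜) :=
  SchwartzMap.smulLeftCLM 𝕜 (planeWave 𝕜 a θ)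

theorem waveMul_apply (a : V) (θ : ℝ) (f : 𝓢(V, 𝕜)) (x : V) :
    waveMul a θ f x = planeWave 𝕜 a θ x * f x :=
  SchwartzMap.smulLeftCLM_apply_apply (hasTemperateGrowth_planeWave a θ) f x

theorem lineDerivOp_waveMul (a : V) (θ : ℝ) (v : V) (f : 𝓢(V, 𝕜)) :
    ∂_{v} (waveMul a θ f)
      = (inner ℝ a v : 𝕜) • waveMul a (θ + Real.pi / 2) f + waveMul a θ (∂_{v} f) := by
  ext x
  refine (lineDerivOp_smulLeftCLM_apply (hasTemperateGrowth_planeWave a θ) v f x).trans ?_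
  rw [(hasFDerivAt_planeWave a θ x).fderiv, add_apply, smul_apply, waveMul_apply, waveMul_apply,
    ContinuousLinearMap.smulRight_apply, innerSL_apply_apply, RCLike.real_smul_eq_coe_mul,
    smul_eq_mul, mul_assoc]

/-- The dilation `f ↦ f (s ·)` of Schwartz functions. -/
def dilate (s : ℝˣ) : 𝓢(V, 𝕜) →L[𝕜] 𝓢(V, 𝕜) :=
  SchwartzMap.compCLMOfContinuousLinearEquiv 𝕜 (ContinuousLinearEquiv.smulLeft (R₁ := ℝ) s)

theorem dilate_apply (s : ℝˣ) (f : 𝓢(V, 𝕜)) (x : V) : dilate s f x = f ((s : ℝ) • x) := rfl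

theorem lineDerivOp_dilate (s : ℝˣ) (v : V) (f : 𝓢(V, 𝕜)) :
    ∂_{v} (dilate s f) = ((s : ℝ) : 𝕜) • dilate s (∂_{v} f) := by
  ext x
  have h := congrArg (· x) (SchwartzMap.lineDerivOp_compCLMOfContinuousLinearEquiv 𝕜 v
    (ContinuousLinearEquiv.smulLeft (R₁ := ℝ) s : V ≃L[ℝ] V) f)
  refine h.trans ?_
  change (∂_{(s : ℝ) • v} f) ((s : ℝ) • x) = _
  rw [LineDeriv.lineDerivOp_left_smul]
  exact RCLike.real_smul_eq_coe_mul _ _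

end PlaneWaves

section WaveIntegrals

variable {𝕜 : Type*} [RCLike 𝕜] {V : Type*} [NormedAddCommGroup V] [InnerProductSpace ℝ V]
  [MeasurableSpace V] {ν : Measure V} {u : V → 𝕜}

variable [BorelSpace V]

theorem integrable_mul_planeWave (hu : Integrable u ν) (a : V) (θ : ℝ) :
    Integrable (fun x => u x * planeWave 𝕜 a θ x) ν :=
  hu.mul_bdd (continuous_planeWave a θ).aestronglyMeasurable
    (ae_of_all _ (norm_planeWave_le a θ))

theorem hasDerivAt_integral_mul_planeWave_smul (hu : Integrable u ν) {a : V}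
    (hau : Integrable (fun x => u x * (inner ℝ a x : ℝ)) ν) (θ r : ℝ) :
    HasDerivAt (fun r : ℝ => ∫ x, u x * planeWave 𝕜 (r • a) θ x ∂ν)
      (∫ x, u x * (inner ℝ a x : ℝ) * planeWave 𝕜 (r • a) (θ + Real.pi / 2) x ∂ν) r := by
  have hderiv (r : ℝ) (x : V) : HasDerivAt (fun r : ℝ => u x * planeWave 𝕜 (r • a) θ x)
      (u x * (inner ℝ a x : ℝ) * planeWave 𝕜 (r • a) (θ + Real.pi / 2) x) r := by
    rw [mul_assoc]
    exact (hasDerivAt_planeWave_smul a θ r x).const_mul (u x)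
  refine (hasDerivAt_integral_of_dominated_loc_of_deriv_le univ_mem
    (.of_forall fun r => (integrable_mul_planeWave hu (r • a) θ).aestronglyMeasurable)
    (integrable_mul_planeWave hu (r • a) θ)
    (integrable_mul_planeWave hau (r • a) (θ + Real.pi / 2)).aestronglyMeasurable
    (ae_of_all _ fun x r _ => ?_) hau.norm (ae_of_all _ fun x r _ => hderiv r x)).2
  rw [norm_mul]
  exact mul_le_of_le_one_right (norm_nonneg _) (norm_planeWave_le _ _ x)

theorem tendsto_integral_mul_dilate {g : V → 𝕜} (hg : Integrable g ν) (f : 𝓢(V, 𝕜))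
    {s : ℕ → ℝ} (hs : Tendsto s atTop (𝓝 0)) :
    Tendsto (fun k => ∫ x, g x * f (s k • x) ∂ν) atTop (𝓝 ((∫ x, g x ∂ν) * f 0)) := by
  rw [← integral_mul_const]
  refine tendsto_integral_of_dominated_convergence
    (fun x => ‖g x‖ * SchwartzMap.seminorm ℝ 0 0 f) (fun k => ?_) (hg.norm.mul_const _)
    (fun k => ae_of_all _ fun x => ?_) (ae_of_all _ fun x => ?_)
  · exact hg.1.mul (f.continuous.comp (continuous_const_smul _)).aestronglyMeasurable
  · rw [norm_mul]
    exact mul_le_mul_of_nonneg_left (f.norm_le_seminorm ℝ _) (norm_nonneg _)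
  · have hx : Tendsto (fun k => s k • x) atTop (𝓝 0) := by simpa using hs.smul_const x
    exact ((f.continuous.tendsto 0).comp hx).const_mul _

end WaveIntegrals

section CharacteristicFunctions

variable {V : Type*} [NormedAddCommGroup V] [InnerProductSpace ℝ V] [MeasurableSpace V]
  {ν : Measure V}

theorem charFun_withDensity_ofReal {u : V → ℝ} (hu : Integrable u ν) (a : V) :
    charFun (ν.withDensity fun x => ENNReal.ofReal (u x)) a
      = ∫ x, max (u x) 0 • Complex.exp ((inner ℝ x a : ℝ) * Complex.I) ∂ν := by
  rw [charFun_apply, integral_withDensity_eq_integral_toReal_smul₀ hu.1.aemeasurable.ennreal_ofReal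
    (ae_of_all _ fun _ => ENNReal.ofReal_lt_top)]
  simp only [ENNReal.toReal_ofReal']

variable [BorelSpace V] [SecondCountableTopology V] [CompleteSpace V]

theorem ae_eq_zero_of_integral_smul_cexp {u : V → ℝ} (hu : Integrable u ν)
    (h : ∀ a, ∫ x, u x • Complex.exp ((inner ℝ x a : ℝ) * Complex.I) ∂ν = 0) : u =ᵐ[ν] 0 := by
  have hfin := isFiniteMeasure_withDensity_ofReal hu.2
  have hfin' := isFiniteMeasure_withDensity_ofReal hu.neg.2
  have hint {w : V → ℝ} (hw : Integrable w ν) (a : V) :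
      Integrable (fun x => max (w x) 0 • Complex.exp ((inner ℝ x a : ℝ) * Complex.I)) ν :=
    hw.pos_part.smul_bdd 1 (Continuous.aestronglyMeasurable (by fun_prop))
      (ae_of_all _ fun x => (Complex.norm_exp_ofReal_mul_I _).le)
  have hdensity : ν.withDensity (fun x => ENNReal.ofReal (u x))
      = ν.withDensity fun x => ENNReal.ofReal ((-u) x) := by
    refine Measure.ext_of_charFun (funext fun a => ?_)
    rw [charFun_withDensity_ofReal hu, charFun_withDensity_ofReal hu.neg, ← sub_eq_zero,
      ← integral_sub (hint hu a) (hint hu.neg a), ← h a]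
    simp only [← sub_smul, Pi.neg_apply, max_zero_sub_max_neg_zero_eq_self]
  have hae := (withDensity_eq_iff hu.1.aemeasurable.ennreal_ofReal
    hu.neg.1.aemeasurable.ennreal_ofReal hu.lintegral_lt_top.ne).1 hdensity
  filter_upwards [hae] with x hx
  have hparts := congrArg ENNReal.toReal hx
  rw [ENNReal.toReal_ofReal', ENNReal.toReal_ofReal'] at hparts
  rw [← max_zero_sub_max_neg_zero_eq_self (u x)]
  exact sub_eq_zero.2 hparts

theorem ae_eq_zero_of_integral_mul_planeWave_real {u : V → ℝ} (hu : Integrable u ν)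
    (h : ∀ a θ, ∫ x, u x * planeWave ℝ a θ x ∂ν = 0) : u =ᵐ[ν] 0 := by
  refine ae_eq_zero_of_integral_smul_cexp hu fun a => ?_
  have hexp (x : V) : u x • Complex.exp ((inner ℝ x a : ℝ) * Complex.I)
      = (u x * planeWave ℝ a 0 x : ℝ)
        + (u x * planeWave ℝ a (-(Real.pi / 2)) x : ℝ) * Complex.I := by
    simp only [planeWave, RCLike.ofReal_real_eq_id, id, add_zero, ← sub_eq_add_neg,
      Real.cos_sub_pi_div_two, Complex.exp_mul_I, real_inner_comm a x, Complex.real_smul]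
    push_cast
    ring
  simp only [hexp]
  rw [integral_add (integrable_mul_planeWave hu a 0).ofReal
    ((integrable_mul_planeWave hu a _).ofReal.mul_const _), integral_mul_const,
    integral_complex_ofReal, integral_complex_ofReal, h, h]
  simp

theorem ae_eq_zero_of_integral_mul_planeWave {𝕜 : Type*} [RCLike 𝕜] {u : V → 𝕜}
    (hu : Integrable u ν) (h : ∀ a θ, ∫ x, u x * planeWave 𝕜 a θ x ∂ν = 0) : u =ᵐ[ν] 0 := by
  have hre := ae_eq_zero_of_integral_mul_planeWave_real hu.re fun a θ => by
    have hint := integral_re (integrable_mul_planeWave hu a θ)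
    rw [h, map_zero] at hint
    simpa only [planeWave, RCLike.re_mul_ofReal, RCLike.ofReal_real_eq_id, id] using hint
  have him := ae_eq_zero_of_integral_mul_planeWave_real hu.im fun a θ => by
    have hint := integral_im (integrable_mul_planeWave hu a θ)
    rw [h, map_zero] at hint
    simpa only [planeWave, RCLike.im_mul_ofReal, RCLike.ofReal_real_eq_id, id] using hint
  filter_upwards [hre, him] with x hxre hxim
  exact RCLike.ext (by simpa using hxre) (by simpa using hxim)

end CharacteristicFunctions

section EulerEquation

theorem eq_zero_of_smul_add_smul_deriv_eq_zero {E : Type*} [NormedAddCommGroup E] [NormedSpace ℝ E]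
    {m m' : ℝ → E} {A c : ℝ} (hc : 0 < c) (hderiv : ∀ r, HasDerivAt m (m' r) r)
    (hode : ∀ r, (c + A * r ^ 2) • m r + r • m' r = 0) {r : ℝ} (hr : 0 < r) : m r = 0 := by
  -- In the variable `t = -log r`, `r ^ c * exp (A * r ^ 2 / 2)` is an integrating factor.
  let k : ℝ → E := fun t => Real.exp (-(c * t) + A * Real.exp (-t) ^ 2 / 2) • m (Real.exp (-t))
  have hk (t : ℝ) : HasDerivAt k 0 t := by
    have hexp : HasDerivAt (fun t => Real.exp (-t)) (-Real.exp (-t)) t := by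
      simpa using (hasDerivAt_neg t).exp
    have hexponent : HasDerivAt (fun t => -(c * t) + A * Real.exp (-t) ^ 2 / 2)
        (-(c + A * Real.exp (-t) ^ 2)) t := by
      refine (((hasDerivAt_id t).const_mul c).fun_neg.fun_add
        (((hexp.fun_pow 2).const_mul A).div_const 2)).congr_deriv ?_
      push_cast
      ring
    refine (hexponent.exp.smul ((hderiv _).scomp t hexp)).congr_deriv ?_
    have hvanish := congrArg (-Real.exp (-(c * t) + A * Real.exp (-t) ^ 2 / 2) • ·)
      (hode (Real.exp (-t)))
    simp only [smul_zero] at hvanish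
    rw [← hvanish, Function.comp_apply]
    module
  have hlim : Tendsto k atTop (𝓝 0) := by
    have hexp : Tendsto (fun t : ℝ => Real.exp (-t)) atTop (𝓝 0) :=
      Real.tendsto_exp_neg_atTop_nhds_zero
    have hm := (hderiv 0).continuousAt.tendsto.comp hexp
    have hfactor := (((hexp.pow 2).const_mul A).div_const 2).rexp
    have hdecay : Tendsto (fun t : ℝ => Real.exp (-(c * t))) atTop (𝓝 0) :=
      hexp.comp (tendsto_id.const_mul_atTop hc)
    simpa only [k, Function.comp_def, Real.exp_add, zero_mul, zero_smul] using
      (hdecay.mul hfactor).smul hm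
  have hconst := is_const_of_deriv_eq_zero (fun t => (hk t).differentiableAt) fun t => (hk t).deriv
  have hzero (t : ℝ) : k t = 0 :=
    tendsto_nhds_unique (tendsto_const_nhds.congr (hconst t)) hlim
  simpa [k, Real.exp_log hr] using hzero (-Real.log r)

end EulerEquation

section DenseRange

variable {𝕜 : Type*} [RCLike 𝕜] {d : ℕ}

theorem ouOp_waveMul_apply (a : Rd d) (θ : ℝ) (f : 𝓢(Rd d, 𝕜)) (x : Rd d) :
    ouOp 𝕜 d (waveMul a θ f) x
      = planeWave 𝕜 a θ x * (ouOp 𝕜 d f x - ((‖a‖ ^ 2 : ℝ) : 𝕜) * f x)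
        + planeWave 𝕜 a (θ + Real.pi / 2) x
          * (2 * (∂_{a} f) x - ((inner ℝ a x : ℝ) : 𝕜) * f x) := by
  have hnorm : ((‖a‖ ^ 2 : ℝ) : 𝕜) = ∑ i, ((a i : ℝ) : 𝕜) ^ 2 := by
    rw [EuclideanSpace.real_norm_sq_eq]
    push_cast
    rfl
  have hinner : ((inner ℝ a x : ℝ) : 𝕜) = ∑ i, ((x i : ℝ) : 𝕜) * ((a i : ℝ) : 𝕜) := by
    simp [PiLp.inner_apply]
  have hderiv : (∂_{a} f) x = ∑ i, ((a i : ℝ) : 𝕜) * (∂_{basisVec i} f) x := by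
    have ha : ∑ i, a i • basisVec i = a := by
      simpa using (EuclideanSpace.basisFun (Fin d) ℝ).sum_repr a
    simp only [SchwartzMap.lineDerivOp_apply_eq_fderiv]
    conv_lhs => rw [← ha]
    simp only [map_sum, map_smul, RCLike.real_smul_eq_coe_mul]
  have hcoord (i : Fin d) : inner ℝ a (basisVec i) = a i := by
    simp [EuclideanSpace.inner_single_right]
  simp only [ouOp_eq_sum, lineDerivOp_waveMul, LineDeriv.lineDerivOp_add,
    LineDeriv.lineDerivOp_smul, sum_apply, sub_apply, add_apply, smul_apply, coordMul_apply,
    waveMul_apply, planeWave_add_pi_div_two_add_pi_div_two, smul_eq_mul, hnorm, hinner, hderiv,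
    hcoord, Finset.mul_sum, Finset.sum_mul, ← Finset.sum_add_distrib, ← Finset.sum_sub_distrib]
  refine Finset.sum_congr rfl fun i _ => ?_
  ring

theorem ouOp_dilate_apply (s : ℝˣ) (f : 𝓢(Rd d, 𝕜)) (x : Rd d) :
    ouOp 𝕜 d (dilate s f) x
      = ((s : ℝ) : 𝕜) ^ 2 * lapOp 𝕜 d f ((s : ℝ) • x) - eulerOp 𝕜 d f ((s : ℝ) • x) := by
  simp only [ouOp_eq_sum, lapOp_eq_sum, eulerOp_eq_sum, lineDerivOp_dilate,
    LineDeriv.lineDerivOp_smul, sum_apply, sub_apply, smul_apply, coordMul_apply, dilate_apply,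
    smul_eq_mul, PiLp.smul_apply, Finset.mul_sum, ← Finset.sum_sub_distrib]
  refine Finset.sum_congr rfl fun i _ => ?_
  push_cast
  ring

theorem exists_schwartzMap_apply_zero_eq_one : ∃ f : 𝓢(Rd d, 𝕜), f 0 = 1 := by
  let b : ContDiffBump (0 : Rd d) := ⟨1, 2, one_pos, one_lt_two⟩
  have hsupp : HasCompactSupport fun x => ((b x : ℝ) : 𝕜) :=
    b.hasCompactSupport.comp_left (g := fun r : ℝ => (r : 𝕜)) RCLike.ofReal_zero
  refine ⟨hsupp.toSchwartzMap ((RCLike.ofRealCLM (K := 𝕜)).contDiff.comp b.contDiff), ?_⟩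
  change ((b 0 : ℝ) : 𝕜) = 1
  rw [b.one_of_mem_closedBall (by simp [b]), RCLike.ofReal_one]

theorem memLp_id_gauss : MemLp id 2 (gauss d) := by
  have hgauss : Integrable fun x : Rd d => Real.exp (-4⁻¹ * ‖x‖ ^ 2) := by
    refine .of_integral_ne_zero ?_
    rw [GaussianFourier.integral_rexp_neg_mul_sq_norm (by positivity)]
    positivity
  rw [memLp_two_iff_integrable_sq_norm aestronglyMeasurable_id, gauss,
    integrable_withDensity_iff_integrable_smul₀'
      (continuous_rho d).measurable.ennreal_ofReal.aemeasurable
      (ae_of_all _ fun _ => ENNReal.ofReal_lt_top)]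
  simp only [ENNReal.toReal_ofReal (rho_pos d _).le, id, smul_eq_mul]
  refine (hgauss.const_mul (4 * ((2 * Real.pi) ^ ((d : ℝ) / 2))⁻¹)).mono'
    ((continuous_rho d).mul (by fun_prop)).aestronglyMeasurable (ae_of_all _ fun x => ?_)
  rw [Real.norm_of_nonneg (mul_nonneg (rho_pos d x).le (sq_nonneg _))]
  have hsq : ‖x‖ ^ 2 ≤ 4 * Real.exp (4⁻¹ * ‖x‖ ^ 2) := by
    linarith [Real.add_one_le_exp (4⁻¹ * ‖x‖ ^ 2)]
  calc rho d x * ‖x‖ ^ 2 ≤ rho d x * (4 * Real.exp (4⁻¹ * ‖x‖ ^ 2)) :=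
        mul_le_mul_of_nonneg_left hsq (rho_pos d x).le
    _ = 4 * ((2 * Real.pi) ^ ((d : ℝ) / 2))⁻¹ * Real.exp (-4⁻¹ * ‖x‖ ^ 2) := by
        rw [rho, show -4⁻¹ * ‖x‖ ^ 2 = -‖x‖ ^ 2 / 2 + 4⁻¹ * ‖x‖ ^ 2 by ring, Real.exp_add]
        ring

theorem integrable_mul_inner_gauss (u : Lp 𝕜 2 (gauss d)) (a : Rd d) :
    Integrable (fun x => u x * ((inner ℝ a x : ℝ) : 𝕜)) (gauss d) :=
  (Lp.memLp u).integrable_mul (memLp_id_gauss.const_inner a).ofReal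

theorem integral_mul_dilate_equation {c : 𝕜} {u : Lp 𝕜 2 (gauss d)}
    (hu : ∀ f, l2Pairing (gauss d) u (c • f - ouOp 𝕜 d f) = 0) (a : Rd d) (θ : ℝ)
    (f : 𝓢(Rd d, 𝕜)) (s : ℝˣ) :
    ∫ x, (u x * planeWave 𝕜 a θ x * (c + ((‖a‖ ^ 2 : ℝ) : 𝕜))
        + u x * ((inner ℝ a x : ℝ) : 𝕜) * planeWave 𝕜 a (θ + Real.pi / 2) x)
          * f ((s : ℝ) • x) ∂(gauss d)
      + ∫ x, u x * planeWave 𝕜 a θ x * eulerOp 𝕜 d f ((s : ℝ) • x) ∂(gauss d)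
      = ((s : ℝ) : 𝕜) ^ 2
        * ∫ x, u x * planeWave 𝕜 a θ x * lapOp 𝕜 d f ((s : ℝ) • x) ∂(gauss d)
      + 2 * ((s : ℝ) : 𝕜)
        * ∫ x, u x * planeWave 𝕜 a (θ + Real.pi / 2) x * (∂_{a} f) ((s : ℝ) • x) ∂(gauss d) := by
  have hwave := integrable_mul_planeWave ((Lp.memLp u).integrable one_le_two) a
  have hinner := integrable_mul_planeWave (integrable_mul_inner_gauss u a) a (θ + Real.pi / 2)
  have hdilate {g : Rd d → 𝕜} (hg : Integrable g (gauss d)) (f : 𝓢(Rd d, 𝕜)) :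
      Integrable (fun x => g x * f ((s : ℝ) • x)) (gauss d) :=
    hg.mul_bdd (dilate s f).continuous.aestronglyMeasurable
      (ae_of_all _ ((dilate s f).norm_le_seminorm ℝ))
  have hfield := hdilate (((hwave θ).mul_const (c + ((‖a‖ ^ 2 : ℝ) : 𝕜))).fun_add hinner) f
  have heuler := hdilate (hwave θ) (eulerOp 𝕜 d f)
  have hlap := (hdilate (hwave θ) (lapOp 𝕜 d f)).const_mul (((s : ℝ) : 𝕜) ^ 2)
  have hlineDeriv := (hdilate (hwave (θ + Real.pi / 2)) (∂_{a} f)).const_mul (2 * ((s : ℝ) : 𝕜))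
  rw [← integral_const_mul, ← integral_const_mul, ← integral_add hfield heuler,
    ← integral_add hlap hlineDeriv, ← sub_eq_zero,
    ← integral_sub (hfield.fun_add heuler) (hlap.fun_add hlineDeriv),
    ← hu (waveMul a θ (dilate s f)), l2Pairing_apply]
  refine integral_congr_ae (ae_of_all _ fun x => ?_)
  simp only [sub_apply, smul_apply, smul_eq_mul, ouOp_waveMul_apply, ouOp_dilate_apply,
    waveMul_apply, lineDerivOp_dilate, dilate_apply]
  ring

theorem integral_planeWave_equation {c : 𝕜} {u : Lp 𝕜 2 (gauss d)}
    (hu : ∀ f, l2Pairing (gauss d) u (c • f - ouOp 𝕜 d f) = 0) (a : Rd d) (θ : ℝ) :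
    (c + ((‖a‖ ^ 2 : ℝ) : 𝕜)) * ∫ x, u x * planeWave 𝕜 a θ x ∂(gauss d)
      + ∫ x, u x * ((inner ℝ a x : ℝ) : 𝕜) * planeWave 𝕜 a (θ + Real.pi / 2) x ∂(gauss d)
      = 0 := by
  obtain ⟨χ, hχ⟩ := exists_schwartzMap_apply_zero_eq_one (𝕜 := 𝕜) (d := d)
  have hwave := integrable_mul_planeWave ((Lp.memLp u).integrable one_le_two) a
  have hinner := integrable_mul_planeWave (integrable_mul_inner_gauss u a) a (θ + Real.pi / 2)
  have hfield := ((hwave θ).mul_const (c + ((‖a‖ ^ 2 : ℝ) : 𝕜))).fun_add hinner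
  let s (k : ℕ) : ℝˣ := Units.mk0 (1 / ((k : ℝ) + 1)) (by positivity)
  have hs : Tendsto (fun k => (s k : ℝ)) atTop (𝓝 0) := tendsto_one_div_add_atTop_nhds_zero_nat
  have hs' : Tendsto (fun k => ((s k : ℝ) : 𝕜)) atTop (𝓝 0) := by
    simpa only [Function.comp_def, RCLike.ofReal_zero] using
      ((RCLike.continuous_ofReal (K := 𝕜)).tendsto 0).comp hs
  have hleft := (tendsto_integral_mul_dilate hfield χ hs).add
    (tendsto_integral_mul_dilate (hwave θ) (eulerOp 𝕜 d χ) hs)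
  have hright := ((hs'.pow 2).mul (tendsto_integral_mul_dilate (hwave θ) (lapOp 𝕜 d χ) hs)).add
    ((hs'.const_mul 2).mul
      (tendsto_integral_mul_dilate (hwave (θ + Real.pi / 2)) (∂_{a} χ) hs))
  have hzero := tendsto_nhds_unique hleft
    (hright.congr fun k => (integral_mul_dilate_equation hu a θ χ (s k)).symm)
  have heuler : eulerOp 𝕜 d χ 0 = 0 := by rw [eulerOp_apply, map_zero]
  simp only [hχ, heuler, mul_one, mul_zero, zero_mul, add_zero, ne_eq,
    OfNat.ofNat_ne_zero, not_false_eq_true, zero_pow] at hzero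
  rwa [integral_add ((hwave θ).mul_const _) hinner, integral_mul_const, mul_comm] at hzero

theorem eq_zero_of_l2Pairing_smul_sub_ouOp {c : ℝ} (hc : 0 < c) {u : Lp 𝕜 2 (gauss d)}
    (hu : ∀ f, l2Pairing (gauss d) u ((c : 𝕜) • f - ouOp 𝕜 d f) = 0) : u = 0 := by
  have hint : Integrable u (gauss d) := (Lp.memLp u).integrable one_le_two
  rw [Lp.eq_zero_iff_ae_eq_zero]
  refine ae_eq_zero_of_integral_mul_planeWave hint fun a θ => ?_
  rw [← one_smul ℝ a]
  refine eq_zero_of_smul_add_smul_deriv_eq_zero (A := ‖a‖ ^ 2)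
    (m := fun r => ∫ x, u x * planeWave 𝕜 (r • a) θ x ∂(gauss d)) hc
    (hasDerivAt_integral_mul_planeWave_smul hint (integrable_mul_inner_gauss u a) θ)
    (fun r => ?_) one_pos
  have hscale : ∫ x, u x * ((inner ℝ (r • a) x : ℝ) : 𝕜)
        * planeWave 𝕜 (r • a) (θ + Real.pi / 2) x ∂(gauss d)
      = r • ∫ x, u x * ((inner ℝ a x : ℝ) : 𝕜)
        * planeWave 𝕜 (r • a) (θ + Real.pi / 2) x ∂(gauss d) := by
    rw [← integral_smul]
    refine integral_congr_ae (ae_of_all _ fun x => ?_)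
    simp only [real_inner_smul_left, RCLike.ofReal_mul, RCLike.real_smul_eq_coe_mul]
    ring
  rw [← integral_planeWave_equation hu (r • a) θ, hscale, RCLike.real_smul_eq_coe_mul, norm_smul,
    mul_pow, Real.norm_eq_abs, sq_abs, mul_comm (r ^ 2), RCLike.ofReal_add]

theorem denseRange_shift_ouOp {c : ℝ} (hc : 0 < c) :
    DenseRange (shift (onSchwartz (gauss d) (ouOp 𝕜 d)).graph c) := by
  refine denseRange_shift fun z hz => eq_zero_of_l2Pairing_smul_sub_ouOp hc fun f => ?_
  have hf := hz _ _ ((mem_graph_onSchwartz_iff _).2 ⟨schwartzConj f, rfl, rfl⟩)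
  rw [← map_smul, ← map_sub, inner_eq_zero_symm, inner_schwartzToL2_left] at hf
  rw [← hf, ouOp_schwartzConj]
  congr 1
  ext x
  simp [schwartzConj_apply, RCLike.real_smul_eq_coe_mul]

end DenseRange

section Closure

variable {𝕜 : Type*} [RCLike 𝕜] {d : ℕ}

theorem isMDissipative_closure_ouOp :
    IsMDissipative (onSchwartz (gauss d) (ouOp 𝕜 d)).closure :=
  isDissipative_ouOp.isMDissipative_closure (dense_domain_onSchwartz _ _)
    isSymmetricOp_ouOp.isClosable fun _ => denseRange_shift_ouOp

theorem inner_one_eq_integral {X : Type*} [MeasurableSpace X] {ν : Measure X}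
    [IsFiniteMeasure ν] (f : Lp 𝕜 2 ν) :
    inner 𝕜 (Lp.const 2 ν (1 : 𝕜)) f = ∫ x, f x ∂ν := by
  rw [L2.inner_def]
  refine integral_congr_ae ?_
  filter_upwards [Lp.coeFn_const (p := 2) (μ := ν) (1 : 𝕜)] with x hx
  rw [hx, RCLike.inner_apply]
  simp

theorem integral_closure_ouOp {x y : Lp 𝕜 2 (gauss d)}
    (hxy : (x, y) ∈ (onSchwartz (gauss d) (ouOp 𝕜 d)).closure.graph) :
    ∫ z, y z ∂(gauss d) = 0 := by
  have hsymm := isSymmetricOp_ouOp (𝕜 := 𝕜) (d := d)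
  rw [← hsymm.isClosable.graph_closure_eq_closure_graph] at hxy
  rw [← inner_one_eq_integral]
  have hclosed : IsClosed {p : Lp 𝕜 2 (gauss d) × Lp 𝕜 2 (gauss d) |
      inner 𝕜 (Lp.const 2 (gauss d) (1 : 𝕜)) p.2 = 0} :=
    isClosed_eq (continuous_const.inner continuous_snd) continuous_const
  refine closure_minimal ?_ hclosed hxy
  rintro ⟨a, b⟩ hab
  obtain ⟨f, rfl, rfl⟩ := (mem_graph_onSchwartz_iff _).1 hab
  change inner 𝕜 _ (schwartzToL2 (gauss d) (ouOp 𝕜 d f)) = 0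
  rw [inner_one_eq_integral, ← integral_ouOp_gauss f]
  exact integral_congr_ae ((ouOp 𝕜 d f).coeFn_toLp 2 (gauss d))

theorem isSemigroupInvariant_of_isGenerator {T : ℝ≥0 → Lp 𝕜 2 (gauss d) →L[𝕜] Lp 𝕜 2 (gauss d)}
    (hT : IsC0ContractionSemigroup T)
    (hgen : IsGenerator (onSchwartz (gauss d) (ouOp 𝕜 d)).closure T) :
    IsSemigroupInvariant (gauss d) T := by
  have hint (f : Lp 𝕜 2 (gauss d)) : Integrable (f : Rd d → 𝕜) (gauss d) :=
    (Lp.memLp f).integrable one_le_two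
  have hinner (f : Lp 𝕜 2 (gauss d)) :
      innerSL 𝕜 (Lp.const 2 (gauss d) (1 : 𝕜)) f = ∫ x, f x ∂(gauss d) := inner_one_eq_integral f
  refine fun t f => ⟨hint _, hint _, ?_⟩
  have hannihilate (x y : Lp 𝕜 2 (gauss d))
      (hxy : (x, y) ∈ (onSchwartz (gauss d) (ouOp 𝕜 d)).closure.graph) :
      innerSL 𝕜 (Lp.const 2 (gauss d) (1 : 𝕜)) y = 0 :=
    (hinner y).trans (integral_closure_ouOp hxy)
  have hdense := (isMDissipative_closure_ouOp (𝕜 := 𝕜) (d := d)).dense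
  rw [← hinner, ← hinner]
  exact hgen.functional_invariant hdense hT _ hannihilate t f

end Closure

end OrnsteinUhlenbeck

end

theorem proposition2p15 {𝕜 : Type*} [RCLike 𝕜] (d : ℕ) :
    -- (1) the adjoint of `L₀` in `L²(dx)` is `Δ + x · ∇ + d`: it extends this operator on `S(ℝ^d)`,
    -- and in general it acts as this operator in the sense of distributions, on all `g ∈ L²(dx)`
    -- for which the result is in `L²(dx)`
    (Dense ((onSchwartz volume (ouOp 𝕜 d)).domain : Set (Lp 𝕜 2 (volume : Measure (Rd d)))) ∧
      onSchwartz volume (ouDualOp 𝕜 d) ≤ (onSchwartz volume (ouOp 𝕜 d)).adjoint ∧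
      ∀ g h : Lp 𝕜 2 (volume : Measure (Rd d)),
        (g, h) ∈ (onSchwartz volume (ouOp 𝕜 d)).adjoint.graph ↔ SolvesDualWeakly g h) ∧
    -- (2) `μ` is `(L₀, S(ℝ^d))`-invariant
    IsOperatorInvariant (gauss d) (onSchwartz (gauss d) (ouOp 𝕜 d)) ∧
    -- (3) the adjoint of `L₀` in `L²(μ)` equals `L₀` on `S(ℝ^d)`, so `L₀` is symmetric in `L²(μ)`
    IsSymmetricOp (onSchwartz (gauss d) (ouOp 𝕜 d)) ∧
    -- (4) `L₀` is closable in `L²(μ)` and its closure is self-adjoint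
    ((onSchwartz (gauss d) (ouOp 𝕜 d)).IsClosable ∧
      IsSelfAdjoint (onSchwartz (gauss d) (ouOp 𝕜 d)).closure) ∧
    -- (5) the closure generates exactly one strongly continuous contraction semigroup on `L²(μ)`,
    -- and `μ` is invariant under it
    ∃ T : ℝ≥0 → Lp 𝕜 2 (gauss d) →L[𝕜] Lp 𝕜 2 (gauss d),
      IsC0ContractionSemigroup T ∧
      IsGenerator (onSchwartz (gauss d) (ouOp 𝕜 d)).closure T ∧
      (∀ T' : ℝ≥0 → Lp 𝕜 2 (gauss d) →L[𝕜] Lp 𝕜 2 (gauss d),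
        IsC0ContractionSemigroup T' →
        IsGenerator (onSchwartz (gauss d) (ouOp 𝕜 d)).closure T' → T' = T) ∧
      IsSemigroupInvariant (gauss d) T := by
  refine ⟨⟨dense_domain_onSchwartz _ _, onSchwartz_ouDualOp_le_adjoint, fun g h => ?_⟩,
    isOperatorInvariant_ouOp, isSymmetricOp_ouOp, ⟨isSymmetricOp_ouOp.isClosable, ?_⟩, ?_⟩
  · rw [mem_graph_adjoint_onSchwartz_iff volume ouOp_schwartzConj, solvesDualWeakly_iff]
  · exact isSymmetricOp_ouOp.closure.isSelfAdjoint
      (isMDissipative_closure_ouOp.surjective_shift one_pos)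
  · have hA := isMDissipative_closure_ouOp (𝕜 := 𝕜) (d := d)
    obtain ⟨T, hT, hgen⟩ := hA.exists_semigroup
    exact ⟨T, hT, hgen, fun T' hT' hgen' => hgen'.unique hA.dense hT' hT hgen,
      isSemigroupInvariant_of_isGenerator hT hgen⟩
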